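/- Let $\alpha\geqslant 1$ and $\beta$ be real numbers, let $1<c<\frac{12}{11}$, and put $\gamma=c^{-1}$. Let $\mathscr{N}_{\alpha,\beta}^{(c)}=\{\lfloor \alpha n^c+\beta\rfloor : n=1,2,3,\dots\}$. For a real number $x\geqslant 2$ and integers $a$ and $q\geqslant 1$ write $$\vartheta(x;q,a)=\sum_{\substack{p\leqslant x\\ p\equiv a\,(\mathrm{mod}\,q)}}\log p,\qquad \vartheta_{\alpha,\beta,c}(x;q,a)=\sum_{\substack{p\leqslant x,\ p\in\mathscr{N}_{\alpha,\beta}^{(c)}\\ p\equiv a\,(\mathrm{mod}\,q)}}\log p,$$ where $p$ runs over primes. Then for every $\varepsilon>0$ and all such $x$, $q$ and $a$ (in particular for all coprime $a$ and $q$), $$\vartheta_{\alpha,\beta,c}(x;q,a)=\alpha^{-\gamma}\gamma x^{\gamma-1}\vartheta(x;q,a)+\alpha^{-\gamma}\gamma(1-\gamma)\int_2^x u^{\gamma-2}\vartheta(u;q,a)\,\mathrm{d}u+O\big(x^{7\gamma/13+11/26+\varepsilon}\big),$$ where the implied constant depends only on $\alpha,\beta,c$ and $\varepsilon$; in particular it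 does not depend on $x$, $q$ or $a$. -/

import Mathlib

/-- The generalized Piatetski--Shapiro sequence `(⌊α n ^ c + β⌋)_{n ≥ 1}`, as a set of integers. -/
def genPiatetskiShapiro (α β c : ℝ) : Set ℤ :=
  {m : ℤ | ∃ n : ℕ, 1 ≤ n ∧ m = ⌊α * (n : ℝ) ^ c + β⌋}

/-- `ϑ(x; q, a)`: the sum of `log p` over the primes `p ≤ x` with `p ≡ a (mod q)`. -/
noncomputable def thetaAP (x : ℝ) (q : ℕ) (a : ℤ) : ℝ :=
  ∑ p ∈ (Finset.Icc 1 ⌊x⌋₊).filter (fun p : ℕ => p.Prime ∧ (p : ℤ) ≡ a [ZMOD (q : ℤ)]),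
    Real.log (p : ℝ)

open scoped Classical in
/-- `ϑ_{α,β,c}(x; q, a)`: the sum of `log p` over the primes `p ≤ x` with `p ≡ a (mod q)` that
belong to the generalized Piatetski--Shapiro sequence. -/
noncomputable def thetaPS (α β c x : ℝ) (q : ℕ) (a : ℤ) : ℝ :=
  ∑ p ∈ (Finset.Icc 1 ⌊x⌋₊).filter (fun p : ℕ => p.Prime ∧
      (p : ℤ) ∈ genPiatetskiShapiro α β c ∧ (p : ℤ) ≡ a [ZMOD (q : ℤ)]),
    Real.log (p : ℝ)

/-! With `γ = 1 / c`, a prime `p` lies in the sequence exactly when the interval between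
`((p - β) / α) ^ γ` and `((p + 1 - β) / α) ^ γ` catches an integer. The indicator is therefore the
length of this interval, which is `α ^ (-γ) γ p ^ (γ - 1)` up to `O(1 / p)`, plus a difference of
two sawtooth values. Partial summation turns the length into the main terms.

The sawtooth sums are squeezed between difference quotients, with step `x ^ (-δ)`, of the periodic
antiderivative of the sawtooth, whose Fourier series converges absolutely. This leaves exponential
sums with phase `h ((p - β) / α) ^ γ` over primes in a residue class. Additive characters modulo `q`
remove the congruence at the cost of a linear term in the phase, which every estimate based on
second derivatives ignores; hence the uniformity in `q` and `a`. Vaughan's identity reduces to type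
I sums, where van der Corput's second derivative test applies directly, and type II sums, where it
applies to the correlations of nearby multiples after splitting one variable into blocks of length
`x ^ (2 δ)` and using the Cauchy–Schwarz inequality. The choice `δ = (3 - 2 γ) / 14` gives the
exponent `1 - δ = γ / 7 + 11 / 14`, which is at most `7 γ / 13 + 11 / 26` when `γ ≥ 11 / 12`. -/

section ExponentialSums

open Finset ComplexConjugate

/-- The additive character `t ↦ exp (2πit)` of `ℝ`: Mathlib's `Real.fourierChar`, with values in `ℂ`
instead of `Circle`. -/
noncomputable def unitExp : AddChar ℝ ℂ := Circle.coeHom.compAddChar Real.fourierChar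

theorem unitExp_apply (t : ℝ) : unitExp t = Complex.exp ((2 * Real.pi * t : ℝ) * Complex.I) :=
  Real.fourierChar_apply t

theorem norm_unitExp (t : ℝ) : ‖unitExp t‖ = 1 := Circle.norm_coe _

theorem unitExp_sub (s t : ℝ) : unitExp (s - t) = unitExp s * conj (unitExp t) := by
  rw [sub_eq_add_neg, AddChar.map_add_eq_mul]
  congr 1
  simp only [unitExp_apply, ← Complex.exp_conj, map_mul, Complex.conj_ofReal, Complex.conj_I]
  push_cast
  ring_nf

theorem unitExp_intCast (k : ℤ) : unitExp k = 1 := by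
  rw [unitExp_apply, Complex.exp_eq_one_iff]
  exact ⟨k, by push_cast; ring⟩

theorem unitExp_sub_intCast (t : ℝ) (k : ℤ) : unitExp (t - k) = unitExp t := by
  rw [unitExp_sub, unitExp_intCast, map_one, mul_one]

theorem norm_sum_unitExp_le_card {ι : Type*} (s : Finset ι) (f : ι → ℝ) :
    ‖∑ n ∈ s, unitExp (f n)‖ ≤ #s :=
  (norm_sum_le _ _).trans (by simp [norm_unitExp])

theorem norm_one_sub_unitExp (t : ℝ) : ‖1 - unitExp t‖ = 2 * |Real.sin (Real.pi * t)| := by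
  rw [norm_sub_rev, unitExp_apply, mul_comm (_ : ℂ), Complex.norm_exp_I_mul_ofReal_sub_one,
    Real.norm_eq_abs, abs_mul, abs_two, show 2 * Real.pi * t / 2 = Real.pi * t by ring]

theorem inv_one_sub_unitExp {t : ℝ} (ht : unitExp t ≠ 1) :
    (1 - unitExp t)⁻¹ = 1 / 2 + (Real.cot (Real.pi * t) / 2 : ℝ) * Complex.I := by
  have hne : 1 - unitExp t ≠ 0 := sub_ne_zero.2 ht.symm
  have hcot := Complex.cot_pi_eq_exp_ratio t
  rw [show 2 * (Real.pi : ℂ) * Complex.I * t = (2 * Real.pi * t : ℝ) * Complex.I by push_cast; ring,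
    ← unitExp_apply] at hcot
  push_cast
  rw [hcot]
  field_simp [Complex.I_ne_zero]
  ring

theorem two_mul_le_sin_pi_mul {Δ t : ℝ} (h₀ : 0 ≤ Δ) (h₁ : Δ ≤ t) (h₂ : t ≤ 1 - Δ) :
    2 * Δ ≤ Real.sin (Real.pi * t) := by
  have hpi := Real.pi_pos
  have hhalf : ∀ s, Δ ≤ s → s ≤ 1 / 2 → 2 * Δ ≤ Real.sin (Real.pi * s) := fun s h₁ h₂ =>
    calc 2 * Δ ≤ 2 / Real.pi * (Real.pi * s) := by field_simp; linarith
      _ ≤ _ := Real.mul_le_sin (by nlinarith) (by nlinarith)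
  rcases le_total t (1 / 2) with h | h
  · exact hhalf t h₁ h
  · rw [← Real.sin_pi_sub, ← mul_one_sub]
    exact hhalf (1 - t) (by linarith) (by linarith)

theorem cot_antitoneOn : AntitoneOn Real.cot (Set.Ioo 0 Real.pi) := by
  rintro s ⟨hs, hs'⟩ t ⟨ht, ht'⟩ hst
  have hsin := Real.sin_nonneg_of_nonneg_of_le_pi (x := t - s) (by linarith) (by linarith)
  rw [Real.sin_sub] at hsin
  rw [Real.cot_eq_cos_div_sin, Real.cot_eq_cos_div_sin,
    div_le_div_iff₀ (Real.sin_pos_of_pos_of_lt_pi ht ht') (Real.sin_pos_of_pos_of_lt_pi hs hs')]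
  linarith

theorem abs_cot_pi_mul_le {Δ t : ℝ} (h₀ : 0 < Δ) (h₁ : Δ ≤ t) (h₂ : t ≤ 1 - Δ) :
    |Real.cot (Real.pi * t)| ≤ 1 / (2 * Δ) := by
  have hs := two_mul_le_sin_pi_mul h₀.le h₁ h₂
  rw [Real.cot_eq_cos_div_sin, abs_div, abs_of_pos (a := Real.sin _) (by linarith)]
  exact div_le_div₀ zero_le_one (Real.abs_cos_le_one _) (by linarith) hs

theorem norm_sum_Ico_le_of_eq_mul_sub {z c : ℕ → ℂ} {a m : ℕ} (ham : a ≤ m)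
    (hz : ∀ n, ‖z n‖ ≤ 1) (h : ∀ n ∈ Ico a (m + 1), z n = c n * (z n - z (n + 1))) :
    ‖∑ n ∈ Ico a (m + 1), z n‖ ≤ ‖c a‖ + ‖c m‖ + ∑ n ∈ Ico a m, ‖c (n + 1) - c n‖ := by
  have parts : ∑ n ∈ Ico a (m + 1), z n =
      c a * z a - c m * z (m + 1) + ∑ n ∈ Ico a m, (c (n + 1) - c n) * z (n + 1) := by
    induction m, ham using Nat.le_induction with
    | base =>
      rw [Nat.Ico_succ_singleton, sum_singleton, Ico_self, sum_empty]
      linear_combination h a (by simp)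
    | succ m ham ih =>
      have hm := h (m + 1) (by simp; omega)
      rw [sum_Ico_succ_top (by omega : a ≤ m + 1),
        sum_Ico_succ_top ham fun n => (c (n + 1) - c n) * z (n + 1),
        ih fun n hn => h n (by simp only [mem_Ico] at hn ⊢; omega)]
      linear_combination hm
  have hmul : ∀ w n, ‖w * z n‖ ≤ ‖w‖ := fun w n => by
    rw [norm_mul]; exact mul_le_of_le_one_right (norm_nonneg _) (hz n)
  rw [parts]
  refine (norm_add_le _ _).trans (add_le_add ?_ (norm_sum_le_of_le _ fun n _ => hmul _ _))
  exact (norm_sub_le _ _).trans (add_le_add (hmul _ _) (hmul _ _))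

theorem one_sub_unitExp_ne_zero {t : ℝ} (h₀ : 0 < t) (h₁ : t < 1) : 1 - unitExp t ≠ 0 := by
  have hsin : 0 < Real.sin (Real.pi * t) :=
    Real.sin_pos_of_pos_of_lt_pi (by positivity) (by nlinarith [Real.pi_pos])
  rw [← norm_pos_iff, norm_one_sub_unitExp]
  positivity

theorem norm_inv_one_sub_unitExp_le {Δ t : ℝ} (h₀ : 0 < Δ) (h₁ : Δ ≤ t) (h₂ : t ≤ 1 - Δ) :
    ‖(1 - unitExp t)⁻¹‖ ≤ 1 / (4 * Δ) := by
  rw [norm_inv, norm_one_sub_unitExp, ← one_div]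
  refine one_div_le_one_div_of_le (by positivity) ?_
  linarith [two_mul_le_sin_pi_mul h₀.le h₁ h₂, le_abs_self (Real.sin (Real.pi * t))]

theorem norm_inv_one_sub_unitExp_sub {s t : ℝ} (h₀ : 0 < s) (hst : s ≤ t) (h₁ : t < 1) :
    ‖(1 - unitExp t)⁻¹ - (1 - unitExp s)⁻¹‖ =
      (Real.cot (Real.pi * s) - Real.cot (Real.pi * t)) / 2 := by
  have hpi := Real.pi_pos
  have hcot : Real.cot (Real.pi * t) ≤ Real.cot (Real.pi * s) :=
    cot_antitoneOn ⟨by positivity, by nlinarith⟩ ⟨by nlinarith, by nlinarith⟩ (by gcongr)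
  have hdiff : (1 - unitExp t)⁻¹ - (1 - unitExp s)⁻¹ =
      ((Real.cot (Real.pi * t) - Real.cot (Real.pi * s)) / 2 : ℝ) * Complex.I := by
    rw [inv_one_sub_unitExp (sub_ne_zero.1 (one_sub_unitExp_ne_zero h₀ (hst.trans_lt h₁))).symm,
      inv_one_sub_unitExp (sub_ne_zero.1 (one_sub_unitExp_ne_zero (h₀.trans_le hst) h₁)).symm]
    push_cast
    ring
  rw [hdiff, norm_mul, Complex.norm_I, mul_one, Complex.norm_real, Real.norm_eq_abs,
    abs_of_nonpos (by linarith)]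
  ring

/- Write `unitExp (f n) = c n * (unitExp (f n) - unitExp (f (n + 1)))`. The multipliers
`c n = (1 - unitExp (f (n + 1) - f n))⁻¹` move monotonically along the line `re = 1 / 2`, so their
total variation telescopes. -/
theorem norm_sum_Ico_unitExp_le_of_diff_mem_Icc {f : ℕ → ℝ} {a b : ℕ} {Δ : ℝ} (hΔ : 0 < Δ)
    (hmono : MonotoneOn (fun n => f (n + 1) - f n) (Ico a b))
    (hlow : ∀ n ∈ Ico a b, Δ ≤ f (n + 1) - f n)
    (hup : ∀ n ∈ Ico a b, f (n + 1) - f n ≤ 1 - Δ) :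
    ‖∑ n ∈ Ico a b, unitExp (f n)‖ ≤ 1 / Δ := by
  rcases le_or_gt b a with hba | hab
  · rw [Ico_eq_empty (by omega), sum_empty, norm_zero]
    positivity
  obtain ⟨m, rfl⟩ : ∃ m, b = m + 1 := ⟨b - 1, by omega⟩
  have ha : a ∈ Ico a (m + 1) := by simp; omega
  have hm : m ∈ Ico a (m + 1) := by simp; omega
  set θ : ℕ → ℝ := fun n => f (n + 1) - f n with hθ
  set c : ℕ → ℂ := fun n => (1 - unitExp (θ n))⁻¹ with hc
  have hpos : ∀ n ∈ Ico a (m + 1), 0 < θ n := fun n hn => hΔ.trans_le (hlow n hn)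
  have hlt : ∀ n ∈ Ico a (m + 1), θ n < 1 := fun n hn => (hup n hn).trans_lt (by linarith)
  have hterm : ∀ n ∈ Ico a (m + 1), unitExp (f n) = c n * (unitExp (f n) - unitExp (f (n + 1))) :=
    fun n hn => by
      have hadd : unitExp (f (n + 1)) = unitExp (f n) * unitExp (θ n) := by
        rw [← AddChar.map_add_eq_mul, hθ, add_sub_cancel]
      rw [hadd, hc, ← mul_one_sub, mul_left_comm,
        inv_mul_cancel₀ (one_sub_unitExp_ne_zero (hpos n hn) (hlt n hn)), mul_one]
  have hvar : ∀ n ∈ Ico a m, ‖c (n + 1) - c n‖ =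
      (-Real.cot (Real.pi * θ (n + 1)) / 2) - (-Real.cot (Real.pi * θ n) / 2) := fun n hn => by
    have hn₀ : n ∈ Ico a (m + 1) := by simp only [mem_Ico] at hn ⊢; omega
    have hn₁ : n + 1 ∈ Ico a (m + 1) := by simp only [mem_Ico] at hn ⊢; omega
    rw [hc, norm_inv_one_sub_unitExp_sub (hpos n hn₀) (hmono hn₀ hn₁ n.le_succ) (hlt _ hn₁)]
    ring
  have hsum := norm_sum_Ico_le_of_eq_mul_sub (z := fun n => unitExp (f n)) (c := c)
    (by omega : a ≤ m) (fun n => (norm_unitExp _).le) hterm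
  rw [sum_congr rfl hvar, sum_Ico_sub (fun n => -Real.cot (Real.pi * θ n) / 2) (by omega)] at hsum
  calc _ ≤ 1 / (4 * Δ) + 1 / (4 * Δ) + (1 / (2 * Δ) / 2 + 1 / (2 * Δ) / 2) := by
        linarith [norm_inv_one_sub_unitExp_le hΔ (hlow a ha) (hup a ha),
          norm_inv_one_sub_unitExp_le hΔ (hlow m hm) (hup m hm),
          abs_le.1 (abs_cot_pi_mul_le hΔ (hlow a ha) (hup a ha)),
          abs_le.1 (abs_cot_pi_mul_le hΔ (hlow m hm) (hup m hm))]
    _ = 1 / Δ := by field_simp; norm_num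

theorem kusminLandau {f : ℕ → ℝ} {a b : ℕ} {Δ : ℝ} (hΔ : 0 < Δ) (k : ℤ)
    (hmono : MonotoneOn (fun n => f (n + 1) - f n) (Ico a b))
    (hlow : ∀ n ∈ Ico a b, k + Δ ≤ f (n + 1) - f n)
    (hup : ∀ n ∈ Ico a b, f (n + 1) - f n ≤ k + 1 - Δ) :
    ‖∑ n ∈ Ico a b, unitExp (f n)‖ ≤ 1 / Δ := by
  have hshift : ∀ n : ℕ, f (n + 1) - (k * (n + 1 : ℕ) : ℤ) - (f n - (k * n : ℤ)) =
      f (n + 1) - f n - k := fun n => by push_cast; ring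
  simp_rw [← fun n => unitExp_sub_intCast (f n) (k * n)]
  refine norm_sum_Ico_unitExp_le_of_diff_mem_Icc hΔ ?_ (fun n hn => ?_) fun n hn => ?_
  · simp only [hshift]
    exact fun m hm n hn hmn => sub_le_sub_right (hmono hm hn hmn) _
  · linarith [hshift n, hlow n hn]
  · linarith [hshift n, hup n hn]

theorem exists_eq_Ico_of_ordConnected {s : Finset ℕ} (h : (s : Set ℕ).OrdConnected) :
    ∃ p q, s = Ico p q := by
  rcases s.eq_empty_or_nonempty with rfl | hs
  · exact ⟨0, 0, by simp⟩
  · refine ⟨s.min' hs, s.max' hs + 1, ext fun z => ?_⟩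
    rw [mem_Ico, Nat.lt_succ_iff]
    exact ⟨fun hz => ⟨s.min'_le z hz, s.le_max' z hz⟩,
      fun hz => h.out (s.min'_mem hs) (s.max'_mem hs) hz⟩

theorem card_le_of_expanding {s : Finset ℕ} {d : ℕ → ℝ} {μ u R : ℝ} (hμ : 0 < μ) (hR : 0 ≤ R)
    (hexp : ∀ m ∈ s, ∀ n ∈ s, m ≤ n → μ * ((n : ℝ) - m) ≤ d n - d m)
    (hd : ∀ n ∈ s, d n ∈ Set.Icc u (u + R)) : (#s : ℝ) ≤ R / μ + 1 := by
  rcases s.eq_empty_or_nonempty with rfl | hs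
  · rw [card_empty, Nat.cast_zero]
    positivity
  have hsub : s ⊆ Icc (s.min' hs) (s.max' hs) := fun z hz =>
    mem_Icc.2 ⟨s.min'_le z hz, s.le_max' z hz⟩
  have hle : s.min' hs ≤ s.max' hs := s.min'_le _ (s.max'_mem hs)
  have hcard : (#s : ℝ) ≤ (s.max' hs : ℝ) - s.min' hs + 1 := by
    have : #s + s.min' hs ≤ s.max' hs + 1 := by
      have := card_le_card hsub
      rw [Nat.card_Icc] at this
      omega
    have : (#s : ℝ) + s.min' hs ≤ s.max' hs + 1 := by exact_mod_cast this
    linarith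
  have hdist : (s.max' hs : ℝ) - s.min' hs ≤ R / μ := by
    rw [le_div_iff₀ hμ]
    linarith [hexp _ (s.min'_mem hs) _ (s.max'_mem hs) hle, (hd _ (s.min'_mem hs)).1,
      (hd _ (s.max'_mem hs)).2]
  linarith

theorem monotoneOn_of_expanding {s : Finset ℕ} {d : ℕ → ℝ} {μ : ℝ} (hμ : 0 < μ)
    (hexp : ∀ m ∈ s, ∀ n ∈ s, m ≤ n → μ * ((n : ℝ) - m) ≤ d n - d m) : MonotoneOn d s :=
  fun m hm n hn hmn => by
    have hcast : (m : ℝ) ≤ n := by exact_mod_cast hmn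
    nlinarith [hexp m hm n hn hmn]

theorem norm_sum_unitExp_filter_diff_mem_Icc_le {f : ℕ → ℝ} {a b : ℕ} {Δ : ℝ} (hΔ : 0 < Δ) (k : ℤ)
    (hmono : MonotoneOn (fun n => f (n + 1) - f n) (Ico a b)) :
    ‖∑ n ∈ Ico a b with k + Δ ≤ f (n + 1) - f n ∧ f (n + 1) - f n ≤ k + 1 - Δ, unitExp (f n)‖ ≤
      1 / Δ := by
  set t := {n ∈ Ico a b | k + Δ ≤ f (n + 1) - f n ∧ f (n + 1) - f n ≤ k + 1 - Δ}
  have hmem : ∀ n ∈ t, n ∈ Ico a b ∧ k + Δ ≤ f (n + 1) - f n ∧ f (n + 1) - f n ≤ k + 1 - Δ :=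
    fun n hn => mem_filter.1 hn
  have hconn : (t : Set ℕ).OrdConnected := ⟨fun x hx y hy z hz => by
    obtain ⟨hxI, hx, -⟩ := hmem x hx
    obtain ⟨hyI, -, hy⟩ := hmem y hy
    have hzI : z ∈ Ico a b :=
      mem_Ico.2 ⟨(mem_Ico.1 hxI).1.trans hz.1, hz.2.trans_lt (mem_Ico.1 hyI).2⟩
    exact mem_filter.2 ⟨hzI, hx.trans (hmono hxI hzI hz.1), (hmono hzI hyI hz.2).trans hy⟩⟩
  obtain ⟨p, q, hpq⟩ := exists_eq_Ico_of_ordConnected hconn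
  rw [hpq] at hmem ⊢
  exact kusminLandau hΔ k (hmono.mono fun n hn => (hmem n hn).1)
    (fun n hn => (hmem n hn).2.1) fun n hn => (hmem n hn).2.2

/- The differences within `√μ` of an integer are few because the differences expand; the others are
handled by the Kusmin–Landau inequality. -/
theorem norm_sum_unitExp_filter_floor_diff_le {f : ℕ → ℝ} {a b : ℕ} {μ : ℝ} (hμ : 0 < μ)
    (hμ' : μ ≤ 1 / 4)
    (hexp : ∀ m ∈ Ico a b, ∀ n ∈ Ico a b, m ≤ n →
      μ * ((n : ℝ) - m) ≤ f (n + 1) - f n - (f (m + 1) - f m)) (k : ℤ) :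
    ‖∑ n ∈ Ico a b with ⌊f (n + 1) - f n⌋ = k, unitExp (f n)‖ ≤ 4 / √μ := by
  have hΔ := Real.sqrt_pos.2 hμ
  have hss := Real.mul_self_sqrt hμ.le
  set Δ := √μ
  set d : ℕ → ℝ := fun n => f (n + 1) - f n
  set s := {n ∈ Ico a b | ⌊d n⌋ = k} with hs
  have hfloor : ∀ n ∈ s, k ≤ d n ∧ d n < k + 1 := fun n hn => Int.floor_eq_iff.1 (mem_filter.1 hn).2
  have hshort : ∀ t ⊆ s, ∀ u, (∀ n ∈ t, d n ∈ Set.Icc u (u + Δ)) →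
      ‖∑ n ∈ t, unitExp (f n)‖ ≤ 1 / Δ + 1 := fun t ht u hu => by
    rw [show 1 / Δ = Δ / μ by rw [← hss]; field_simp]
    refine (norm_sum_unitExp_le_card _ _).trans (card_le_of_expanding hμ hΔ.le ?_ hu)
    exact fun m hm n hn => hexp m (mem_filter.1 (ht hm)).1 n (mem_filter.1 (ht hn)).1
  set l := {n ∈ s | d n < k + Δ}
  set r := {n ∈ {n ∈ s | ¬ d n < k + Δ} | k + 1 - Δ < d n}
  set t := {n ∈ {n ∈ s | ¬ d n < k + Δ} | ¬ k + 1 - Δ < d n} with ht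
  have hl : ‖∑ n ∈ l, unitExp (f n)‖ ≤ 1 / Δ + 1 :=
    hshort l (filter_subset _ _) k fun n hn => by
      obtain ⟨hns, hn⟩ := mem_filter.1 hn
      exact ⟨(hfloor n hns).1, hn.le⟩
  have hr : ‖∑ n ∈ r, unitExp (f n)‖ ≤ 1 / Δ + 1 :=
    hshort r ((filter_subset _ _).trans (filter_subset _ _)) (k + 1 - Δ) fun n hn => by
      obtain ⟨hn', hn⟩ := mem_filter.1 hn
      exact ⟨hn.le, by linarith [(hfloor n (mem_filter.1 hn').1).2]⟩
  have hmid : ‖∑ n ∈ t, unitExp (f n)‖ ≤ 1 / Δ := by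
    have ht_eq : t = {n ∈ Ico a b | k + Δ ≤ d n ∧ d n ≤ k + 1 - Δ} := ext fun n => by
      simp only [ht, hs, mem_filter, not_lt, Int.floor_eq_iff]
      exact ⟨fun ⟨⟨⟨h, _⟩, h₁⟩, h₂⟩ => ⟨h, h₁, h₂⟩,
        fun ⟨h, h₁, h₂⟩ => ⟨⟨⟨h, by linarith, by linarith⟩, h₁⟩, h₂⟩⟩
    rw [ht_eq]
    exact norm_sum_unitExp_filter_diff_mem_Icc_le hΔ k (monotoneOn_of_expanding hμ hexp)
  have hsplit : ∑ n ∈ s, unitExp (f n) =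
      ∑ n ∈ l, unitExp (f n) + (∑ n ∈ r, unitExp (f n) + ∑ n ∈ t, unitExp (f n)) := by
    rw [sum_filter_add_sum_filter_not, sum_filter_add_sum_filter_not]
  have hone : 2 ≤ 1 / Δ := by rw [le_div_iff₀ hΔ]; nlinarith
  calc _ ≤ 1 / Δ + 1 + (1 / Δ + 1 + 1 / Δ) := by
        rw [hsplit]
        exact norm_add_le_of_le hl (norm_add_le_of_le hr hmid)
    _ ≤ 4 * (1 / Δ) := by linarith
    _ = 4 / Δ := by ring

theorem diff_sub_diff_mem_Icc_of_second_difference {f : ℕ → ℝ} {a b : ℕ} {u v : ℝ}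
    (h : ∀ n, a ≤ n → n + 1 < b → f (n + 2) - 2 * f (n + 1) + f n ∈ Set.Icc u v) {m n : ℕ}
    (ham : a ≤ m) (hmn : m ≤ n) (hnb : n < b) :
    f (n + 1) - f n - (f (m + 1) - f m) ∈ Set.Icc (u * ((n : ℝ) - m)) (v * ((n : ℝ) - m)) := by
  induction n, hmn using Nat.le_induction with
  | base => simp
  | succ n hmn ih =>
    obtain ⟨ih₁, ih₂⟩ := ih (by omega)
    obtain ⟨h₁, h₂⟩ := h n (by omega) hnb
    push_cast
    exact ⟨by linarith, by linarith⟩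

theorem norm_sum_unitExp_le_of_second_difference {f : ℕ → ℝ} {a b : ℕ} {μ M : ℝ} (hab : a ≤ b)
    (hμ : 0 < μ) (hμ' : μ ≤ 1 / 4) (hM : 0 ≤ M)
    (h : ∀ n, a ≤ n → n + 1 < b → f (n + 2) - 2 * f (n + 1) + f n ∈ Set.Icc μ (M * μ)) :
    ‖∑ n ∈ Ico a b, unitExp (f n)‖ ≤ (M * μ * ((b : ℝ) - a) + 2) * (4 / √μ) := by
  rcases hab.eq_or_lt with rfl | hab
  · rw [Ico_self, sum_empty, norm_zero, sub_self]
    positivity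
  set d : ℕ → ℝ := fun n => f (n + 1) - f n
  have hexp : ∀ m ∈ Ico a b, ∀ n ∈ Ico a b, m ≤ n → μ * ((n : ℝ) - m) ≤ d n - d m :=
    fun m hm n hn hmn => (diff_sub_diff_mem_Icc_of_second_difference h (mem_Ico.1 hm).1 hmn
      (mem_Ico.1 hn).2).1
  have hmono := monotoneOn_of_expanding hμ hexp
  have hlast : b - 1 ∈ Ico a b := by rw [mem_Ico]; omega
  have hmaps : ∀ n ∈ Ico a b, ⌊d n⌋ ∈ Icc ⌊d a⌋ ⌊d (b - 1)⌋ := fun n hn => mem_Icc.2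
    ⟨Int.floor_mono (hmono (left_mem_Ico.2 hab) hn (mem_Ico.1 hn).1),
      Int.floor_mono (hmono hn hlast (by have := (mem_Ico.1 hn).2; omega))⟩
  have hcard : (#(Icc ⌊d a⌋ ⌊d (b - 1)⌋) : ℝ) ≤ M * μ * ((b : ℝ) - a) + 2 := by
    have hle := (mem_Icc.1 (hmaps a (left_mem_Ico.2 hab))).2
    have hcard_eq : (#(Icc ⌊d a⌋ ⌊d (b - 1)⌋) : ℝ) = ⌊d (b - 1)⌋ + 1 - ⌊d a⌋ := by
      exact_mod_cast Int.card_Icc_of_le _ _ (by omega)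
    have hgrowth := (diff_sub_diff_mem_Icc_of_second_difference h le_rfl
      (mem_Ico.1 hlast).1 (mem_Ico.1 hlast).2).2
    rw [Nat.cast_sub (by omega), Nat.cast_one] at hgrowth
    have hMμ : 0 ≤ M * μ := by positivity
    linarith [Int.floor_le (d (b - 1)), Int.lt_floor_add_one (d a)]
  calc ‖∑ n ∈ Ico a b, unitExp (f n)‖
      = ‖∑ k ∈ Icc ⌊d a⌋ ⌊d (b - 1)⌋, ∑ n ∈ Ico a b with ⌊d n⌋ = k, unitExp (f n)‖ := by
        rw [sum_fiberwise_of_maps_to hmaps]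
    _ ≤ #(Icc ⌊d a⌋ ⌊d (b - 1)⌋) * (4 / √μ) := by
        refine (norm_sum_le_of_le _ fun k _ =>
          norm_sum_unitExp_filter_floor_diff_le hμ hμ' hexp k).trans ?_
        rw [sum_const, nsmul_eq_mul]
    _ ≤ _ := by gcongr

theorem exists_second_difference_eq {f f' f'' : ℝ → ℝ} {x : ℝ}
    (hf : ∀ y ∈ Set.Icc x (x + 2), HasDerivAt f (f' y) y)
    (hf' : ∀ y ∈ Set.Icc x (x + 2), HasDerivAt f' (f'' y) y) :
    ∃ η ∈ Set.Icc x (x + 2), f (x + 2) - 2 * f (x + 1) + f x = f'' η := by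
  have hdiff : ∀ y ∈ Set.Icc x (x + 1),
      HasDerivAt (fun y => f (y + 1) - f y) (f' (y + 1) - f' y) y := fun y hy =>
    ((hf (y + 1) ⟨by linarith [hy.1], by linarith [hy.2]⟩).comp_add_const y 1).sub
      (hf y ⟨hy.1, by linarith [hy.2]⟩)
  obtain ⟨ξ, hξ, hξ_eq⟩ := exists_hasDerivAt_eq_slope _ _ (lt_add_one x)
    (fun y hy => (hdiff y hy).continuousAt.continuousWithinAt)
    (fun y hy => hdiff y (Set.Ioo_subset_Icc_self hy))
  have hsub : Set.Icc ξ (ξ + 1) ⊆ Set.Icc x (x + 2) :=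
    Set.Icc_subset_Icc hξ.1.le (by linarith [hξ.2])
  obtain ⟨η, hη, hη_eq⟩ := exists_hasDerivAt_eq_slope f' f'' (lt_add_one ξ)
    (fun y hy => (hf' y (hsub hy)).continuousAt.continuousWithinAt)
    (fun y hy => hf' y (hsub (Set.Ioo_subset_Icc_self hy)))
  refine ⟨η, hsub (Set.Ioo_subset_Icc_self hη), ?_⟩
  rw [add_sub_cancel_left, div_one] at hξ_eq hη_eq
  rw [hη_eq, hξ_eq, add_assoc, one_add_one_eq_two]
  ring

theorem vanDerCorput_second_deriv {f f' f'' : ℝ → ℝ} {A B : ℕ} {μ M : ℝ} (hμ : 0 < μ)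
    (hM : 1 ≤ M) (hf : ∀ y ∈ Set.Icc (A + 1 : ℝ) B, HasDerivAt f (f' y) y)
    (hf' : ∀ y ∈ Set.Icc (A + 1 : ℝ) B, HasDerivAt f' (f'' y) y)
    (hf'' : ∀ y ∈ Set.Icc (A + 1 : ℝ) B, f'' y ∈ Set.Icc μ (M * μ)) :
    ‖∑ n ∈ Ioc A B, unitExp (f n)‖ ≤ 4 * M * (B - A : ℕ) * √μ + 9 / √μ := by
  have hΔ := Real.sqrt_pos.2 hμ
  have hss := Real.mul_self_sqrt hμ.le
  rcases lt_or_ge (1 / 4) μ with hbig | hsmall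
  · have hhalf : 1 / 4 ≤ √μ := by nlinarith
    calc ‖∑ n ∈ Ioc A B, unitExp (f n)‖ ≤ (B - A : ℕ) := by
          rw [← Nat.card_Ioc]; exact norm_sum_unitExp_le_card _ fun n : ℕ => f n
      _ = 4 * 1 * (B - A : ℕ) * (1 / 4) := by ring
      _ ≤ 4 * M * (B - A : ℕ) * √μ := by gcongr
      _ ≤ _ := le_add_of_nonneg_right (by positivity)
  rcases Nat.lt_or_ge A B with h | h
  swap
  · rw [Ioc_eq_empty (by omega), sum_empty, norm_zero]
    positivity
  have hsecond : ∀ n : ℕ, A + 1 ≤ n → n + 1 < B →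
      f (n + 2 : ℕ) - 2 * f (n + 1 : ℕ) + f (n : ℕ) ∈ Set.Icc μ (M * μ) := fun n h₁ h₂ => by
    have hn₁ : (A + 1 : ℝ) ≤ n := by exact_mod_cast h₁
    have hn₂ : (n : ℝ) + 2 ≤ B := by exact_mod_cast (by omega : n + 2 ≤ B)
    have hsub : Set.Icc (n : ℝ) (n + 2) ⊆ Set.Icc (A + 1 : ℝ) B := Set.Icc_subset_Icc hn₁ hn₂
    obtain ⟨η, hη, heq⟩ := exists_second_difference_eq (fun y hy => hf y (hsub hy))
      (fun y hy => hf' y (hsub hy))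
    push_cast
    rw [heq]
    exact hf'' η (hsub hη)
  have hmain := norm_sum_unitExp_le_of_second_difference (f := fun n => f n)
    (by omega : A + 1 ≤ B) hμ hsmall (by positivity) hsecond
  have hlen : (B : ℝ) - (A + 1 : ℕ) ≤ (B - A : ℕ) := by
    push_cast [Nat.cast_sub h.le]
    linarith
  have hone : 1 ≤ 1 / √μ := by rw [le_div_iff₀ hΔ]; nlinarith
  rw [← Ico_succ_succ_eq_Ioc, Order.succ_eq_add_one, Order.succ_eq_add_one,
    sum_Ico_succ_top (by omega)]
  calc _ ≤ (M * μ * ((B : ℝ) - (A + 1 : ℕ)) + 2) * (4 / √μ) + 1 :=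
        norm_add_le_of_le hmain (norm_unitExp _).le
    _ ≤ (M * μ * (B - A : ℕ) + 2) * (4 / √μ) + 1 / √μ := by gcongr
    _ = 4 * M * (B - A : ℕ) * √μ + 9 / √μ := by
        field_simp
        linear_combination 4 * M * ((B - A : ℕ) : ℝ) * (-hss)

end ExponentialSums

section Sawtooth

open Finset

/-- The sawtooth function `ψ(t) = {t} - 1 / 2`, whose increments detect integers. -/
noncomputable def sawtooth (t : ℝ) : ℝ := Int.fract t - 1 / 2

/-- The periodic antiderivative `B₂({t}) / 2` of the sawtooth function; unlike `sawtooth` it has an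
absolutely convergent Fourier series. -/
noncomputable def sawtoothPrim (t : ℝ) : ℝ := (Int.fract t ^ 2 - Int.fract t + 1 / 6) / 2

theorem abs_sawtooth_le (t : ℝ) : |sawtooth t| ≤ 1 / 2 := by
  rw [sawtooth, abs_le]
  constructor <;> linarith [Int.fract_nonneg t, Int.fract_lt_one t]

theorem fract_add_eq_or {Δ : ℝ} (hΔ₀ : 0 < Δ) (hΔ₁ : Δ ≤ 1) (t : ℝ) :
    Int.fract (t + Δ) = Int.fract t + Δ ∨
      Int.fract (t + Δ) = Int.fract t + Δ - 1 ∧ 0 ≤ Int.fract t + Δ - 1 := by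
  have hfloor := Int.floor_add_fract t
  have hnonneg := Int.fract_nonneg t
  have hlt := Int.fract_lt_one t
  simp only [Int.fract_eq_iff]
  rcases lt_or_ge (Int.fract t + Δ) 1 with h | h
  · exact .inl ⟨by linarith, h, ⌊t⌋, by linarith⟩
  · exact .inr ⟨⟨by linarith, by linarith, ⌊t⌋ + 1, by push_cast; linarith⟩, by linarith⟩

theorem sawtoothPrim_add_sub_le {Δ : ℝ} (hΔ₀ : 0 < Δ) (hΔ₁ : Δ ≤ 1) (t : ℝ) :
    sawtoothPrim (t + Δ) - sawtoothPrim t ≤ Δ * (sawtooth t + Δ / 2) := by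
  unfold sawtoothPrim sawtooth
  rcases fract_add_eq_or hΔ₀ hΔ₁ t with h | ⟨h, _⟩ <;> rw [h] <;> nlinarith

theorem le_sawtoothPrim_sub_sub {Δ : ℝ} (hΔ₀ : 0 < Δ) (hΔ₁ : Δ ≤ 1) (t : ℝ) :
    Δ * (sawtooth t - Δ / 2) ≤ sawtoothPrim t - sawtoothPrim (t - Δ) := by
  have hlt := Int.fract_lt_one (t - Δ)
  unfold sawtoothPrim sawtooth
  rcases fract_add_eq_or hΔ₀ hΔ₁ (t - Δ) with h | ⟨h, _⟩ <;> rw [sub_add_cancel] at h <;> rw [h] <;>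
    nlinarith

theorem hasSum_sawtoothPrim (t : ℝ) :
    HasSum (fun h : ℕ => 1 / (2 * Real.pi ^ 2) * (1 / (h : ℝ) ^ 2) * (unitExp (h * t)).re)
      (sawtoothPrim t) := by
  have hcos := (hasSum_one_div_nat_pow_mul_cos (k := 1) one_ne_zero (x := Int.fract t)
    ⟨Int.fract_nonneg t, (Int.fract_lt_one t).le⟩).mul_left (1 / (2 * Real.pi ^ 2))
  convert! hcos using 1
  · funext h
    have hre : (unitExp (h * t)).re = Real.cos (2 * Real.pi * h * Int.fract t) := by
      rw [unitExp_apply, Complex.exp_ofReal_mul_I_re,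
        show 2 * Real.pi * (h * t) =
          2 * Real.pi * h * Int.fract t + (h * ⌊t⌋ : ℤ) * (2 * Real.pi) by
            push_cast; linear_combination -(2 * Real.pi * h) * Int.floor_add_fract t,
        Real.cos_add_int_mul_two_pi]
    rw [hre, mul_assoc]
  · have hbernoulli : (Polynomial.map (algebraMap ℚ ℝ) (Polynomial.bernoulli (2 * 1))).eval
        (Int.fract t) = Int.fract t ^ 2 - Int.fract t + 1 / 6 := by
      simp [Polynomial.bernoulli_def, sum_range_succ, bernoulli]
      ring
    rw [hbernoulli, sawtoothPrim]
    simp only [one_div, mul_inv_rev, Nat.reduceAdd, even_two, Even.neg_pow, one_pow, mul_one,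
      one_mul, Nat.factorial_two, Nat.cast_ofNat]
    field_simp

theorem norm_unitExp_sub_one_le (t : ℝ) : ‖unitExp t - 1‖ ≤ 2 * Real.pi * |t| := by
  rw [unitExp_apply, mul_comm (_ : ℂ)]
  refine Real.norm_exp_I_mul_ofReal_sub_one_le.trans_eq ?_
  rw [Real.norm_eq_abs, abs_mul, abs_of_pos (by positivity)]

theorem sawtoothPrim_fourier_coeff_diff_le {Δ : ℝ} (hΔ : 0 ≤ Δ) {h : ℕ} (hh : 1 ≤ h) :
    1 / (2 * Real.pi ^ 2) * (1 / (h : ℝ) ^ 2) * ‖unitExp (h * Δ) - 1‖ ≤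
      min (Δ / h) (1 / (h : ℝ) ^ 2) := by
  have hpi := Real.pi_gt_three
  have : (0 : ℝ) < h := by exact_mod_cast hh
  refine le_min ?_ ?_
  · calc _ ≤ 1 / (2 * Real.pi ^ 2) * (1 / (h : ℝ) ^ 2) * (2 * Real.pi * (h * Δ)) := by
          gcongr
          simpa only [abs_of_nonneg (by positivity : 0 ≤ h * Δ)] using
            norm_unitExp_sub_one_le (h * Δ)
      _ = Δ / h * (1 / Real.pi) := by field_simp
      _ ≤ Δ / h := mul_le_of_le_one_right (by positivity)
          ((div_le_one (by positivity)).2 (by linarith))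
  · have htwo : ‖unitExp (h * Δ) - 1‖ ≤ 2 := by
      refine (norm_sub_le _ _).trans ?_
      rw [norm_unitExp, norm_one, one_add_one_eq_two]
    calc _ ≤ 1 / (2 * Real.pi ^ 2) * (1 / (h : ℝ) ^ 2) * 2 := by gcongr
      _ = 1 / (h : ℝ) ^ 2 * (1 / Real.pi ^ 2) := by field_simp
      _ ≤ 1 / (h : ℝ) ^ 2 := mul_le_of_le_one_right (by positivity)
          ((div_le_one (by positivity)).2 (by nlinarith))

variable {ι : Type*} {s : Finset ι} {w f : ι → ℝ} {Δ : ℝ} {S : ℕ → ℝ}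

theorem hasSum_sum_mul_sawtoothPrim_diff (s : Finset ι) (w f : ι → ℝ) (Δ : ℝ) :
    HasSum (fun h : ℕ => 1 / (2 * Real.pi ^ 2) * (1 / (h : ℝ) ^ 2) *
        ((unitExp (h * Δ) - 1) * ∑ i ∈ s, (w i : ℂ) * unitExp (h * f i)).re)
      (∑ i ∈ s, w i * (sawtoothPrim (f i + Δ) - sawtoothPrim (f i))) := by
  refine HasSum.congr_fun (hasSum_sum fun i _ =>
    ((hasSum_sawtoothPrim (f i + Δ)).sub (hasSum_sawtoothPrim (f i))).mul_left (w i)) fun h => ?_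
  rw [mul_sum, Complex.re_sum, mul_sum]
  refine sum_congr rfl fun i _ => ?_
  have hshift : (unitExp (h * Δ) - 1) * ((w i : ℂ) * unitExp (h * f i)) =
      w i * (unitExp (h * (f i + Δ)) - unitExp (h * f i)) := by
    rw [mul_add, AddChar.map_add_eq_mul]
    ring
  rw [hshift, Complex.re_ofReal_mul, Complex.sub_re]
  ring

theorem abs_sum_mul_sawtoothPrim_diff_le (hΔ : 0 ≤ Δ)
    (hS : ∀ h : ℕ, 1 ≤ h → ‖∑ i ∈ s, (w i : ℂ) * unitExp (h * f i)‖ ≤ S h)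
    (hsum : Summable fun h : ℕ => min (Δ / h) (1 / (h : ℝ) ^ 2) * S h) :
    |∑ i ∈ s, w i * (sawtoothPrim (f i + Δ) - sawtoothPrim (f i))| ≤
      ∑' h : ℕ, min (Δ / h) (1 / (h : ℝ) ^ 2) * S h := by
  rw [← (hasSum_sum_mul_sawtoothPrim_diff s w f Δ).tsum_eq, ← Real.norm_eq_abs]
  refine tsum_of_norm_bounded hsum.hasSum fun h => ?_
  rcases Nat.eq_zero_or_pos h with rfl | hh
  · simp
  rw [Real.norm_eq_abs, abs_mul, abs_of_nonneg (by positivity)]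
  calc _ ≤ 1 / (2 * Real.pi ^ 2) * (1 / (h : ℝ) ^ 2) *
        (‖unitExp (h * Δ) - 1‖ * ‖∑ i ∈ s, (w i : ℂ) * unitExp (h * f i)‖) := by
        rw [← norm_mul]
        gcongr
        exact Complex.abs_re_le_norm _
    _ ≤ min (Δ / h) (1 / (h : ℝ) ^ 2) * S h := by
        rw [← mul_assoc]
        exact mul_le_mul (sawtoothPrim_fourier_coeff_diff_le hΔ hh) (hS h hh) (norm_nonneg _)
          (by positivity)

/- `Δ * sawtooth` lies between the backward and the forward difference of `sawtoothPrim`, up to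
`Δ ^ 2 / 2`. -/
theorem abs_sum_mul_sawtooth_le (hw : ∀ i ∈ s, 0 ≤ w i) (hΔ₀ : 0 < Δ) (hΔ₁ : Δ ≤ 1)
    (hS : ∀ h : ℕ, 1 ≤ h → ‖∑ i ∈ s, (w i : ℂ) * unitExp (h * f i)‖ ≤ S h)
    (hsum : Summable fun h : ℕ => min (Δ / h) (1 / (h : ℝ) ^ 2) * S h) :
    |∑ i ∈ s, w i * sawtooth (f i)| ≤
      Δ / 2 * ∑ i ∈ s, w i + Δ⁻¹ * ∑' h : ℕ, min (Δ / h) (1 / (h : ℝ) ^ 2) * S h := by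
  have hS' : ∀ h : ℕ, 1 ≤ h → ‖∑ i ∈ s, (w i : ℂ) * unitExp (h * (f i - Δ))‖ ≤ S h := fun h hh => by
    have hfactor : ∑ i ∈ s, (w i : ℂ) * unitExp (h * (f i - Δ)) =
        (∑ i ∈ s, (w i : ℂ) * unitExp (h * f i)) * unitExp (-(h * Δ)) := by
      rw [sum_mul]
      refine sum_congr rfl fun i _ => ?_
      rw [mul_assoc, ← AddChar.map_add_eq_mul, mul_sub, sub_eq_add_neg]
    rw [hfactor, norm_mul, norm_unitExp, mul_one]
    exact hS h hh
  have hforward := (abs_le.1 (abs_sum_mul_sawtoothPrim_diff_le hΔ₀.le hS hsum)).1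
  have hbackward := (abs_le.1 (abs_sum_mul_sawtoothPrim_diff_le hΔ₀.le hS' hsum)).2
  simp only [sub_add_cancel] at hbackward
  have hupper : ∑ i ∈ s, w i * (sawtoothPrim (f i + Δ) - sawtoothPrim (f i)) ≤
      Δ * (∑ i ∈ s, w i * sawtooth (f i) + Δ / 2 * ∑ i ∈ s, w i) := by
    rw [mul_sum, ← sum_add_distrib, mul_sum]
    refine sum_le_sum fun i hi => ?_
    linarith [mul_le_mul_of_nonneg_left (sawtoothPrim_add_sub_le hΔ₀ hΔ₁ (f i)) (hw i hi)]
  have hlower : Δ * (∑ i ∈ s, w i * sawtooth (f i) - Δ / 2 * ∑ i ∈ s, w i) ≤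
      ∑ i ∈ s, w i * (sawtoothPrim (f i) - sawtoothPrim (f i - Δ)) := by
    rw [mul_sum, ← sum_sub_distrib, mul_sum]
    refine sum_le_sum fun i hi => ?_
    linarith [mul_le_mul_of_nonneg_left (le_sawtoothPrim_sub_sub hΔ₀ hΔ₁ (f i)) (hw i hi)]
  set T := ∑' h : ℕ, min (Δ / h) (1 / (h : ℝ) ^ 2) * S h
  have hT : Δ * (Δ⁻¹ * T) = T := mul_inv_cancel_left₀ hΔ₀.ne' T
  rw [abs_le]
  constructor <;> refine le_of_mul_le_mul_left ?_ hΔ₀ <;> linarith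

theorem min_one_inv_mul_one_add_rpow_half_le {ε r : ℝ} (hε : 0 ≤ ε) (hε' : ε ≤ 1 / 2) (hr : 0 < r) :
    min 1 r⁻¹ * (1 + r ^ (1 / 2 : ℝ)) ≤ 2 * r ^ (-ε) := by
  rcases le_total r 1 with h | h
  · calc min 1 r⁻¹ * (1 + r ^ (1 / 2 : ℝ)) ≤ 1 * (1 + 1) := by
          gcongr
          · exact min_le_left _ _
          · exact Real.rpow_le_one hr.le h (by norm_num)
      _ = 2 * 1 := by norm_num
      _ ≤ _ := by
          gcongr
          exact Real.one_le_rpow_of_pos_of_le_one_of_nonpos hr h (by linarith)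
  · calc min 1 r⁻¹ * (1 + r ^ (1 / 2 : ℝ)) ≤ r⁻¹ * (r ^ (1 / 2 : ℝ) + r ^ (1 / 2 : ℝ)) := by
          gcongr
          · exact min_le_right _ _
          · exact Real.one_le_rpow h (by norm_num)
      _ = 2 * r ^ (-1 + 1 / 2 : ℝ) := by
          rw [Real.rpow_add hr, Real.rpow_neg_one]
          ring
      _ ≤ _ := by
          gcongr
          linarith

theorem abs_sum_mul_sawtooth_le_of_forall {ε H R : ℝ} (hε : 0 < ε) (hε' : ε ≤ 1 / 2)
    (hw : ∀ i ∈ s, 0 ≤ w i) (hH : 1 ≤ H) (hR : 0 ≤ R)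
    (hS : ∀ h : ℕ, 1 ≤ h →
      ‖∑ i ∈ s, (w i : ℂ) * unitExp (h * f i)‖ ≤ R * (1 + ((h : ℝ) / H) ^ (1 / 2 : ℝ))) :
    |∑ i ∈ s, w i * sawtooth (f i)| ≤
      H⁻¹ * ∑ i ∈ s, w i + 2 * (∑' h : ℕ, 1 / (h : ℝ) ^ (1 + ε)) * R * H ^ ε := by
  have hH₀ : 0 < H := by linarith
  have hterm : ∀ h : ℕ, min (H⁻¹ / h) (1 / (h : ℝ) ^ 2) * (R * (1 + ((h : ℝ) / H) ^ (1 / 2 : ℝ))) ≤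
      H⁻¹ * (2 * R * H ^ ε) * (1 / (h : ℝ) ^ (1 + ε)) := fun h => by
    rcases Nat.eq_zero_or_pos h with rfl | hpos
    · simp only [Nat.cast_zero, div_zero, ne_eq, OfNat.ofNat_ne_zero, not_false_eq_true, zero_pow,
        min_self, zero_mul]
      positivity
    have hh : (0 : ℝ) < h := by exact_mod_cast hpos
    set r : ℝ := h / H with hr
    have hmin : min (H⁻¹ / h) (1 / (h : ℝ) ^ 2) = H⁻¹ * (1 / h) * min 1 r⁻¹ := by
      rw [mul_min_of_nonneg _ _ (by positivity), hr]
      congr 1 <;> field_simp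
    calc _ = H⁻¹ * (1 / h) * R * (min 1 r⁻¹ * (1 + r ^ (1 / 2 : ℝ))) := by rw [hmin]; ring
      _ ≤ H⁻¹ * (1 / h) * R * (2 * r ^ (-ε)) := by
          exact mul_le_mul_of_nonneg_left
            (min_one_inv_mul_one_add_rpow_half_le hε.le hε' (by positivity)) (by positivity)
      _ = _ := by
          rw [hr, Real.div_rpow hh.le hH₀.le, Real.rpow_add hh, Real.rpow_one, Real.rpow_neg hh.le,
            Real.rpow_neg hH₀.le]
          field_simp
  have hsummable := (Real.summable_one_div_nat_rpow.2 (by linarith : 1 < 1 + ε)).mul_left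
    (H⁻¹ * (2 * R * H ^ ε))
  have hsum := Summable.of_nonneg_of_le (fun h => by positivity) hterm hsummable
  have htsum := hsum.tsum_le_tsum hterm hsummable
  rw [tsum_mul_left] at htsum
  have hW : 0 ≤ ∑ i ∈ s, w i := sum_nonneg hw
  refine (abs_sum_mul_sawtooth_le hw (inv_pos.2 hH₀) (inv_le_one_of_one_le₀ hH) hS hsum).trans
    (add_le_add ?_ ?_)
  · gcongr
    linarith [inv_pos.2 hH₀]
  · calc _ ≤ H⁻¹⁻¹ * (H⁻¹ * (2 * R * H ^ ε) * ∑' h : ℕ, 1 / (h : ℝ) ^ (1 + ε)) := by gcongr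
      _ = _ := by
        rw [inv_inv]
        field_simp

end Sawtooth

section DivisorBound

theorem natCast_add_one_le_mul_pow_rpow {ε b : ℝ} (hε : 0 < ε) (hb : 2 ≤ b) (a : ℕ) :
    (a : ℝ) + 1 ≤ (1 + 1 / (ε * Real.log 2)) * (b ^ a) ^ ε := by
  have := Real.log_pos one_lt_two
  have hexp : 1 + a * (ε * Real.log 2) ≤ (b ^ a) ^ ε := by
    calc 1 + a * (ε * Real.log 2) ≤ Real.exp (a * (ε * Real.log 2)) := by
          linarith [Real.add_one_le_exp (a * (ε * Real.log 2))]
      _ = ((2 : ℝ) ^ a) ^ ε := by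
          rw [← Real.rpow_natCast, ← Real.rpow_mul (by norm_num),
            Real.rpow_def_of_pos (by norm_num)]
          ring_nf
      _ ≤ _ := by gcongr
  calc (a : ℝ) + 1 ≤ a + 1 + (1 / (ε * Real.log 2) + a * (ε * Real.log 2)) :=
        le_add_of_nonneg_right (by positivity)
    _ = (1 + 1 / (ε * Real.log 2)) * (1 + a * (ε * Real.log 2)) := by field_simp; ring
    _ ≤ _ := by gcongr

theorem natCast_add_one_le_pow_rpow {ε b : ℝ} (hb : 0 ≤ b) (hbε : 2 ≤ b ^ ε) (a : ℕ) :
    (a : ℝ) + 1 ≤ (b ^ a) ^ ε := by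
  calc (a : ℝ) + 1 ≤ 2 ^ a := by exact_mod_cast Nat.lt_two_pow_self
    _ ≤ (b ^ ε) ^ a := by gcongr
    _ = _ := by rw [Real.rpow_pow_comm hb]

theorem natCast_rpow_eq_prod_primeFactors {n : ℕ} (hn : n ≠ 0) (ε : ℝ) :
    (n : ℝ) ^ ε = ∏ p ∈ n.primeFactors, ((p : ℝ) ^ n.factorization p) ^ ε := by
  rw [Real.finsetProd_rpow _ _ fun p _ => by positivity]
  congr 1
  conv_lhs => rw [← Nat.prod_factorization_pow_eq_self hn]
  simp [Finsupp.prod]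

theorem exists_card_divisors_le_rpow {ε : ℝ} (hε : 0 < ε) :
    ∃ C : ℝ, 1 ≤ C ∧ ∀ n : ℕ, n ≠ 0 → (n.divisors.card : ℝ) ≤ C * (n : ℝ) ^ ε := by
  -- Only the boundedly many primes with `p ^ ε < 2` can make a factor `a + 1` exceed `p ^ (a ε)`.
  have := Real.log_pos one_lt_two
  set c : ℝ := 1 + 1 / (ε * Real.log 2)
  have hc : 1 ≤ c := le_add_of_nonneg_right (by positivity)
  set K : ℕ := ⌈(2 : ℝ) ^ (1 / ε)⌉₊
  refine ⟨c ^ K, one_le_pow₀ hc, fun n hn => ?_⟩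
  have hfactor : ∀ p ∈ n.primeFactors, ((n.factorization p + 1 : ℕ) : ℝ) ≤
      (if p < K then c else 1) * ((p : ℝ) ^ n.factorization p) ^ ε := fun p hp => by
    push_cast
    split_ifs with hpK
    · have hp₂ : (2 : ℝ) ≤ p := by exact_mod_cast (Nat.prime_of_mem_primeFactors hp).two_le
      exact natCast_add_one_le_mul_pow_rpow hε hp₂ _
    · have hp₂ : 2 ≤ (p : ℝ) ^ ε := by
        have hKp : (2 : ℝ) ^ (1 / ε) ≤ p := Nat.ceil_le.1 (not_lt.1 hpK)
        calc (2 : ℝ) = ((2 : ℝ) ^ (1 / ε)) ^ ε := by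
              rw [← Real.rpow_mul (by norm_num), one_div_mul_cancel hε.ne', Real.rpow_one]
          _ ≤ _ := by gcongr
      rw [one_mul]
      exact natCast_add_one_le_pow_rpow p.cast_nonneg hp₂ _
  have hsmall : ∏ p ∈ n.primeFactors, (if p < K then c else 1 : ℝ) ≤ c ^ K := by
    rw [Finset.prod_ite, Finset.prod_const, Finset.prod_const_one, mul_one]
    refine pow_le_pow_right₀ hc ?_
    simpa using Finset.card_le_card (t := Finset.range K) fun p hp => by
      simpa using (Finset.mem_filter.1 hp).2
  rw [Nat.card_divisors hn, Nat.cast_prod, natCast_rpow_eq_prod_primeFactors hn]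
  calc _ ≤ _ := Finset.prod_le_prod (fun p _ => by positivity) hfactor
    _ ≤ _ := by rw [Finset.prod_mul_distrib]; gcongr

theorem exists_card_divisors_le_rpow_of_mem_Ioc {ε : ℝ} (hε : 0 < ε) :
    ∃ C : ℝ, 1 ≤ C ∧ ∀ x : ℝ, 0 ≤ x → ∀ n ∈ Finset.Ioc 0 ⌊x⌋₊,
      (n.divisors.card : ℝ) ≤ C * x ^ ε := by
  obtain ⟨C, hC, hdiv⟩ := exists_card_divisors_le_rpow hε
  refine ⟨C, hC, fun x hx n hn => ?_⟩
  rw [Finset.mem_Ioc] at hn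
  refine (hdiv n hn.1.ne').trans ?_
  gcongr
  exact (Nat.le_floor_iff hx).1 hn.2

end DivisorBound

section Vaughan

open ArithmeticFunction
open scoped ArithmeticFunction.Moebius ArithmeticFunction.zeta

/-- The restriction of an arithmetic function to arguments at most `U`, as in the splitting
`f = f_{≤ U} + f_{> U}` of Vaughan's identity. The cutoff is real so that it can be a power
of `x`. -/
noncomputable def truncLE (f : ArithmeticFunction ℝ) (U : ℝ) : ArithmeticFunction ℝ :=
  ⟨fun n => if (n : ℝ) ≤ U then f n else 0, by simp⟩

theorem truncLE_apply (f : ArithmeticFunction ℝ) (U : ℝ) (n : ℕ) :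
    truncLE f U n = if (n : ℝ) ≤ U then f n else 0 := rfl

theorem sub_truncLE_apply (f : ArithmeticFunction ℝ) (U : ℝ) (n : ℕ) :
    (f - truncLE f U) n = if (n : ℝ) ≤ U then 0 else f n := by
  rw [sub_eq_add_neg, ArithmeticFunction.add_apply, ArithmeticFunction.neg_apply, truncLE_apply]
  split_ifs <;> simp

theorem abs_truncLE_le (f : ArithmeticFunction ℝ) (U : ℝ) (n : ℕ) :
    |truncLE f U n| ≤ |f n| := by
  rw [truncLE_apply]
  split_ifs <;> simp

theorem abs_sub_truncLE_le (f : ArithmeticFunction ℝ) (U : ℝ) (n : ℕ) :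
    |(f - truncLE f U) n| ≤ |f n| := by
  rw [sub_truncLE_apply]
  split_ifs <;> simp

theorem vaughan_identity (U V : ℝ) :
    Λ = truncLE Λ U + truncLE μ V * log - truncLE μ V * truncLE Λ U * ζ
      + (Λ - truncLE Λ U) * ((μ - truncLE μ V) * ζ) := by
  have hμ : (μ : ArithmeticFunction ℝ) * ζ = 1 := coe_moebius_mul_coe_zeta
  rw [← vonMangoldt_mul_zeta]
  linear_combination (truncLE Λ U - Λ) * hμ

theorem abs_coe_moebius_le_one (n : ℕ) : |(μ : ArithmeticFunction ℝ) n| ≤ 1 := by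
  rw [intCoe_apply]
  exact_mod_cast abs_moebius_le_one

theorem abs_truncLE_mul_truncLE_vonMangoldt_le {f : ArithmeticFunction ℝ} (hf : ∀ n, |f n| ≤ 1)
    (U V : ℝ) (d : ℕ) : |(truncLE f V * truncLE Λ U) d| ≤ Real.log d := by
  rw [ArithmeticFunction.mul_apply, ← vonMangoldt_sum,
    ← Nat.sum_divisorsAntidiagonal' (f := fun _ j => Λ j)]
  refine (Finset.abs_sum_le_sum_abs _ _).trans (Finset.sum_le_sum fun p _ => ?_)
  calc |truncLE f V p.1 * truncLE Λ U p.2| ≤ |f p.1| * |Λ p.2| := by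
        rw [abs_mul]
        exact mul_le_mul (abs_truncLE_le ..) (abs_truncLE_le ..) (abs_nonneg _) (abs_nonneg _)
    _ ≤ 1 * Λ p.2 := by
        rw [abs_of_nonneg (vonMangoldt_nonneg (n := p.2))]
        exact mul_le_mul_of_nonneg_right (hf _) vonMangoldt_nonneg
    _ = Λ p.2 := one_mul _

theorem truncLE_mul_truncLE_eq_zero (f g : ArithmeticFunction ℝ) {U V : ℝ} {d : ℕ}
    (hd : V * U < d) : (truncLE f V * truncLE g U) d = 0 := by
  rw [ArithmeticFunction.mul_apply]
  refine Finset.sum_eq_zero fun p hp => ?_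
  rw [truncLE_apply, truncLE_apply]
  split_ifs with hV hU
  · have hprod : (d : ℝ) = p.1 * p.2 := by exact_mod_cast (Nat.mem_divisorsAntidiagonal.1 hp).1.symm
    have : (p.1 : ℝ) * p.2 ≤ V * U := by gcongr; exact (Nat.cast_nonneg _).trans hV
    linarith
  all_goals simp

theorem abs_sub_truncLE_mul_zeta_le {f : ArithmeticFunction ℝ} (hf : ∀ n, |f n| ≤ 1) (V : ℝ)
    (m : ℕ) : |((f - truncLE f V) * ζ) m| ≤ m.divisors.card := by
  rw [coe_mul_zeta_apply, Finset.card_eq_sum_ones, Nat.cast_sum, Nat.cast_one]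
  exact (Finset.abs_sum_le_sum_abs _ _).trans
    (Finset.sum_le_sum fun i _ => (abs_sub_truncLE_le f V i).trans (hf i))

theorem sub_truncLE_mul_zeta_eq_zero (f : ArithmeticFunction ℝ) {V : ℝ} {m : ℕ}
    (hm : (m : ℝ) ≤ V) : ((f - truncLE f V) * ζ) m = 0 := by
  rw [coe_mul_zeta_apply]
  refine Finset.sum_eq_zero fun i hi => ?_
  have him : (i : ℝ) ≤ m := by exact_mod_cast Nat.divisor_le hi
  rw [sub_truncLE_apply, if_pos (him.trans hm)]

theorem sum_Ioc_mul_apply_mul_eq (f g : ArithmeticFunction ℝ) {N : ℕ} {F : ℕ → ℂ}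
    (hF : ∀ n, N < n → F n = 0) :
    ∑ n ∈ Finset.Ioc 0 N, ((f * g) n : ℂ) * F n =
      ∑ l ∈ Finset.Ioc 0 N, ∑ m ∈ Finset.Ioc 0 N, (f l : ℂ) * (g m : ℂ) * F (l * m) := by
  rw [← Finset.sum_product']
  have hconv : ∀ n ∈ Finset.Ioc 0 N, ((f * g) n : ℂ) * F n =
      ∑ p ∈ Finset.Ioc 0 N ×ˢ Finset.Ioc 0 N with p.1 * p.2 = n,
        (f p.1 : ℂ) * (g p.2 : ℂ) * F (p.1 * p.2) := fun n hn => by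
    rw [Finset.mem_Ioc] at hn
    rw [ArithmeticFunction.mul_apply, Nat.divisorsAntidiagonal_eq_prod_filter_of_le hn.1.ne' hn.2]
    push_cast
    rw [Finset.sum_mul]
    exact Finset.sum_congr rfl fun p hp => by rw [(Finset.mem_filter.1 hp).2]
  simp_rw [Finset.sum_congr rfl hconv, Finset.sum_filter]
  rw [Finset.sum_comm]
  refine Finset.sum_congr rfl fun p hp => ?_
  rw [Finset.mem_product, Finset.mem_Ioc, Finset.mem_Ioc] at hp
  rw [Finset.sum_ite_eq]
  split_ifs with hmem
  · rfl
  · have hlarge : N < p.1 * p.2 := by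
      by_contra! hle
      exact hmem (Finset.mem_Ioc.2 ⟨Nat.mul_pos hp.1.1 hp.2.1, hle⟩)
    rw [hF _ hlarge, mul_zero]

end Vaughan

section BilinearBounds

open Finset ArithmeticFunction
open scoped ArithmeticFunction.Moebius ArithmeticFunction.zeta

/-- A type I estimate for the weight `F` on `[1, N]`: bilinear sums in which one variable carries
a monotone coefficient are bounded as if the inner sum over that variable, for each value of the
other one, were at most `R`. -/
def TypeIBound (F : ℕ → ℂ) (N : ℕ) (R : ℝ) : Prop :=
  ∀ ⦃c w : ℕ → ℝ⦄ ⦃D L : ℝ⦄, Monotone w → 0 ≤ w 0 → 0 ≤ D → 0 ≤ L →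
    (∀ d : ℕ, D < d → c d = 0) → (∀ d ∈ Ioc 0 N, |c d| ≤ L) →
    ‖∑ d ∈ Ioc 0 N, ∑ m ∈ Ioc 0 N, (c d : ℂ) * (w m : ℂ) * F (d * m)‖ ≤ D * L * (w N * R)

/-- A type II estimate for the weight `F` on `[1, N]`: bilinear sums with arbitrary coefficients,
one of them supported in `[Q, T]`, are at most `Z` times the product of their sup norms. -/
def TypeIIBound (F : ℕ → ℂ) (N Q : ℕ) (T Z : ℝ) : Prop :=
  ∀ ⦃a b : ℕ → ℂ⦄ ⦃A B : ℝ⦄, 0 ≤ A → 0 ≤ B →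
    (∀ l ∈ Ioc 0 N, ‖a l‖ ≤ A) → (∀ m ∈ Ioc 0 N, ‖b m‖ ≤ B) →
    (∀ l : ℕ, l < Q → a l = 0) → (∀ l : ℕ, T < l → a l = 0) →
    ‖∑ l ∈ Ioc 0 N, ∑ m ∈ Ioc 0 N, a l * b m * F (l * m)‖ ≤ A * B * Z

variable {F : ℕ → ℂ} {N Q : ℕ} {R T U Z A B : ℝ} {f g : ArithmeticFunction ℝ}

theorem TypeIBound.norm_sum_mul_le (h : TypeIBound F N R) (hF : ∀ n, N < n → F n = 0)
    (hg : Monotone g) (hA : 0 ≤ A) (hB : 0 ≤ B) (hfA : ∀ d : ℕ, A < d → f d = 0)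
    (hfB : ∀ d ∈ Ioc 0 N, |f d| ≤ B) :
    ‖∑ n ∈ Ioc 0 N, ((f * g) n : ℂ) * F n‖ ≤ A * B * (g N * R) := by
  rw [sum_Ioc_mul_apply_mul_eq f g hF]
  exact h hg g.map_zero.ge hA hB hfA hfB

/-- Since `F (l * m)` vanishes when both variables exceed `T`, one of them may be taken to lie
in `[Q, T]`. -/
theorem TypeIIBound.norm_sum_mul_le (h : TypeIIBound F N Q T Z) (hF : ∀ n, N < n → F n = 0)
    (hT : 0 ≤ T) (hNT : (N : ℝ) ≤ T ^ 2) (hA : 0 ≤ A) (hB : 0 ≤ B)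
    (hfA : ∀ l ∈ Ioc 0 N, |f l| ≤ A) (hgB : ∀ m ∈ Ioc 0 N, |g m| ≤ B)
    (hfQ : ∀ l : ℕ, l < Q → f l = 0) (hgQ : ∀ m : ℕ, m < Q → g m = 0) :
    ‖∑ n ∈ Ioc 0 N, ((f * g) n : ℂ) * F n‖ ≤ 2 * (A * B * Z) := by
  let low (k : ArithmeticFunction ℝ) (l : ℕ) : ℂ := if (l : ℝ) ≤ T then (k l : ℂ) else 0
  let high (l : ℕ) : ℂ := if (l : ℝ) ≤ T then 0 else (f l : ℂ)
  have hlow : ∀ {k : ArithmeticFunction ℝ} {K : ℝ}, 0 ≤ K → (∀ l ∈ Ioc 0 N, |k l| ≤ K) →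
      ∀ l ∈ Ioc 0 N, ‖low k l‖ ≤ K := fun hK hk l hl => by
    simp only [low]
    split_ifs
    · simpa using hk l hl
    · simpa using hK
  have hhigh : ∀ l ∈ Ioc 0 N, ‖high l‖ ≤ A := fun l hl => by
    simp only [high]
    split_ifs
    · simpa using hA
    · simpa using hfA l hl
  have hsplit : ∀ l m : ℕ, (f l : ℂ) * (g m : ℂ) * F (l * m) =
      low f l * (g m : ℂ) * F (l * m) + low g m * high l * F (m * l) := fun l m => by
    simp only [low, high]
    split_ifs with hl hm
    · ring
    · ring
    · rw [mul_comm m l]; ring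
    · have hbig : N < l * m := by
        rify
        nlinarith
      rw [hF _ hbig]
      ring
  have hfirst := h hA hB (hlow hA hfA) (b := fun m => (g m : ℂ)) (by simpa using hgB)
    (fun l hl => by simp [low, hfQ l hl]) fun l hl => if_neg hl.not_ge
  have hsecond := h hB hA (hlow hB hgB) hhigh (fun l hl => by simp [low, hgQ l hl])
    fun l hl => if_neg hl.not_ge
  rw [sum_Ioc_mul_apply_mul_eq f g hF]
  simp_rw [hsplit, sum_add_distrib]
  rw [sum_comm (f := fun l m => low g m * high l * F (m * l))]
  linarith [norm_add_le_of_le hfirst hsecond]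

theorem norm_sum_truncLE_mul_le (hF : ∀ n, ‖F n‖ ≤ 1) (hU : 0 ≤ U) (hB : 0 ≤ B)
    (hfB : ∀ n ∈ Ioc 0 N, |f n| ≤ B) :
    ‖∑ n ∈ Ioc 0 N, (truncLE f U n : ℂ) * F n‖ ≤ U * B := by
  have hterm : ∀ n ∈ Ioc 0 N, ‖(truncLE f U n : ℂ) * F n‖ ≤ if (n : ℝ) ≤ U then B else 0 :=
    fun n hn => by
      rw [norm_mul, Complex.norm_real, Real.norm_eq_abs, truncLE_apply]
      split_ifs
      · exact (mul_le_of_le_one_right (abs_nonneg _) (hF n)).trans (hfB n hn)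
      · simp
  have hsub : (Ioc 0 N).filter (fun n : ℕ => (n : ℝ) ≤ U) ⊆ Ioc 0 ⌊U⌋₊ := fun n hn => by
    rw [mem_filter, mem_Ioc] at hn
    exact mem_Ioc.2 ⟨hn.1.1, Nat.le_floor hn.2⟩
  have hcard := card_le_card hsub
  rw [Nat.card_Ioc, Nat.sub_zero] at hcard
  refine (norm_sum_le_of_le _ hterm).trans ?_
  rw [← sum_filter, sum_const, nsmul_eq_mul]
  gcongr
  exact (Nat.cast_le.2 hcard).trans (Nat.floor_le hU)

theorem monotone_log_natCast : Monotone fun n : ℕ => Real.log n := fun m n hmn => by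
  rcases m.eq_zero_or_pos with rfl | hm
  · simpa using Real.log_natCast_nonneg n
  · exact Real.log_le_log (by exact_mod_cast hm) (by exact_mod_cast hmn)

theorem monotone_coe_zeta : Monotone (ζ : ArithmeticFunction ℝ) := fun m n hmn => by
  simp only [natCoe_apply, zeta_apply]
  split_ifs <;> first | omega | simp

theorem norm_sum_vonMangoldt_mul_le (hF₁ : ∀ n, ‖F n‖ ≤ 1) (hF₀ : ∀ n, N < n → F n = 0)
    (hN : 1 ≤ N) (hI : TypeIBound F N R) (hII : TypeIIBound F N Q T Z) (hT : 0 ≤ T)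
    (hNT : (N : ℝ) ≤ T ^ 2) (hQU : (Q : ℝ) ≤ U) (hB : 0 ≤ B)
    (hd : ∀ m ∈ Ioc 0 N, (m.divisors.card : ℝ) ≤ B) :
    ‖∑ n ∈ Ioc 0 N, (Λ n : ℂ) * F n‖ ≤
      Real.log N * (U + (U + U ^ 2) * R + 2 * (B * Z)) := by
  have hU : 0 ≤ U := Q.cast_nonneg.trans hQU
  have hlog : 0 ≤ Real.log N := Real.log_natCast_nonneg N
  have hlog_le : ∀ n ∈ Ioc 0 N, Real.log n ≤ Real.log N := fun n hn =>
    monotone_log_natCast (mem_Ioc.1 hn).2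
  have hΛ : ∀ n ∈ Ioc 0 N, |Λ n| ≤ Real.log N := fun n hn => by
    rw [abs_of_nonneg vonMangoldt_nonneg]
    exact vonMangoldt_le_log.trans (hlog_le n hn)
  have hlt : ∀ l : ℕ, l < Q → (l : ℝ) ≤ U := fun l hl => (Nat.cast_le.2 hl.le).trans hQU
  have hinitial := norm_sum_truncLE_mul_le hF₁ hU hlog hΛ
  have hlogI := hI.norm_sum_mul_le hF₀ monotone_log_natCast (g := log) hU zero_le_one
    (fun d hd => by rw [truncLE_apply, if_neg hd.not_ge])
    fun d _ => (abs_truncLE_le μ U d).trans (abs_coe_moebius_le_one d)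
  have hzetaI := hI.norm_sum_mul_le hF₀ monotone_coe_zeta (mul_nonneg hU hU) hlog
    (fun d hd => truncLE_mul_truncLE_eq_zero μ Λ hd)
    fun d hd => (abs_truncLE_mul_truncLE_vonMangoldt_le abs_coe_moebius_le_one U U d).trans
      (hlog_le d hd)
  have htypeII := hII.norm_sum_mul_le hF₀ hT hNT hlog hB
    (fun n hn => (abs_sub_truncLE_le Λ U n).trans (hΛ n hn))
    (fun m hm => (abs_sub_truncLE_mul_zeta_le abs_coe_moebius_le_one U m).trans (hd m hm))
    (fun l hl => by rw [sub_truncLE_apply, if_pos (hlt l hl)])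
    fun m hm => sub_truncLE_mul_zeta_eq_zero μ (hlt m hm)
  rw [log_apply] at hlogI
  rw [natCoe_apply, zeta_apply_ne (by omega), Nat.cast_one] at hzetaI
  have hsum : ∑ n ∈ Ioc 0 N, (Λ n : ℂ) * F n =
      ∑ n ∈ Ioc 0 N, (truncLE Λ U n : ℂ) * F n + ∑ n ∈ Ioc 0 N, ((truncLE μ U * log) n : ℂ) * F n
        - ∑ n ∈ Ioc 0 N, ((truncLE μ U * truncLE Λ U * ζ) n : ℂ) * F n
        + ∑ n ∈ Ioc 0 N, (((Λ - truncLE Λ U) * ((μ - truncLE μ U) * ζ)) n : ℂ) * F n := by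
    rw [← sum_add_distrib, ← sum_sub_distrib, ← sum_add_distrib]
    refine sum_congr rfl fun n _ => ?_
    conv_lhs => rw [vaughan_identity U U]
    simp only [sub_eq_add_neg, ArithmeticFunction.add_apply,
      ArithmeticFunction.neg_apply, Complex.ofReal_add, Complex.ofReal_neg]
    ring
  rw [hsum]
  linarith [norm_add_le_of_le (norm_sub_le_of_le (norm_add_le_of_le hinitial hlogI) hzetaI) htypeII]

end BilinearBounds

section DyadicSums

open Finset ComplexConjugate

/-- The exponential `unitExp (G n)` cut off to the dyadic window `x / 2 < n ≤ x`, so that sums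
over products `l * m` in the window can run over boxes. -/
noncomputable def dyadicExp (G : ℝ → ℝ) (x : ℝ) (n : ℕ) : ℂ :=
  if x / 2 < n ∧ (n : ℝ) ≤ x then unitExp (G n) else 0

theorem norm_dyadicExp_le (G : ℝ → ℝ) (x : ℝ) (n : ℕ) : ‖dyadicExp G x n‖ ≤ 1 := by
  unfold dyadicExp
  split_ifs <;> simp [norm_unitExp]

theorem dyadicExp_eq_zero (G : ℝ → ℝ) {x : ℝ} {n : ℕ} (h : x < n) : dyadicExp G x n = 0 :=
  if_neg fun h' => h'.2.not_gt h

theorem mem_Ioc_floor_div_iff {x k l : ℝ} (hx : 0 ≤ x) (hk : 0 < k) (hl : 0 < l) (m : ℕ) :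
    m ∈ Ioc ⌊x / (2 * k)⌋₊ ⌊x / l⌋₊ ↔ x / 2 < k * m ∧ l * m ≤ x := by
  rw [mem_Ioc, Nat.floor_lt (by positivity), Nat.le_floor_iff (by positivity),
    div_lt_iff₀ (by positivity), le_div_iff₀ hl, div_lt_iff₀ two_pos]
  constructor <;> rintro ⟨h₁, h₂⟩ <;> constructor <;> linarith

theorem sum_dyadicExp_mul_eq (G : ℝ → ℝ) {x : ℝ} {d : ℕ} (hx : 0 ≤ x) (hd : 1 ≤ d)
    (w : ℕ → ℂ) :
    ∑ m ∈ Ioc 0 ⌊x⌋₊, w m * dyadicExp G x (d * m) =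
      ∑ m ∈ Ioc ⌊x / (2 * d)⌋₊ ⌊x / d⌋₊, w m * unitExp (G (d * m)) := by
  have hd₁ : (1 : ℝ) ≤ d := by exact_mod_cast hd
  have hd₀ : (0 : ℝ) < d := by linarith
  have hmem := mem_Ioc_floor_div_iff hx hd₀ hd₀
  have hsub : Ioc ⌊x / (2 * d)⌋₊ ⌊x / d⌋₊ ⊆ Ioc 0 ⌊x⌋₊ :=
    Ioc_subset_Ioc (Nat.zero_le _) (Nat.floor_mono (div_le_self hx hd₁))
  rw [← sum_subset hsub fun m _ hm => ?_]
  · refine sum_congr rfl fun m hm => ?_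
    simp only [dyadicExp, Nat.cast_mul, if_pos ((hmem m).1 hm)]
  · rw [hmem] at hm
    simp only [dyadicExp, Nat.cast_mul, if_neg hm, mul_zero]

theorem sum_dyadicExp_mul_conj_eq (G : ℝ → ℝ) {x : ℝ} {l₁ l₂ N : ℕ} (hx : 0 ≤ x) (hl₁ : 1 ≤ l₁)
    (hl : l₁ ≤ l₂) (hN : ⌊x / l₂⌋₊ ≤ N) :
    ∑ m ∈ Ioc 0 N, dyadicExp G x (l₂ * m) * conj (dyadicExp G x (l₁ * m)) =
      ∑ m ∈ Ioc ⌊x / (2 * l₁)⌋₊ ⌊x / l₂⌋₊, unitExp (G (l₂ * m) - G (l₁ * m)) := by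
  have hl₁' : (0 : ℝ) < l₁ := by exact_mod_cast hl₁
  have hl₂' : (l₁ : ℝ) ≤ l₂ := by exact_mod_cast hl
  have hmem := mem_Ioc_floor_div_iff hx hl₁' (hl₁'.trans_le hl₂')
  have hmul : ∀ m : ℕ, (l₁ : ℝ) * m ≤ l₂ * m := fun m => by gcongr
  rw [← sum_subset (Ioc_subset_Ioc (Nat.zero_le _) hN) fun m _ hm => ?_]
  · refine sum_congr rfl fun m hm => ?_
    obtain ⟨h₁, h₂⟩ := (hmem m).1 hm
    have h := hmul m
    simp only [dyadicExp, Nat.cast_mul]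
    rw [if_pos ⟨by linarith, h₂⟩, if_pos ⟨h₁, by linarith⟩, unitExp_sub]
  · rw [hmem, not_and_or, not_lt, not_le] at hm
    rcases hm with h | h
    · simp only [dyadicExp, Nat.cast_mul, h.not_gt, false_and, if_false, map_zero, mul_zero]
    · rw [dyadicExp_eq_zero _ (by exact_mod_cast h), zero_mul]

theorem half_le_mul_and_mul_le {x k l : ℝ} (hk : 0 ≤ k) (hl : 0 ≤ l) {A B : ℕ}
    (hAB : ∀ m ∈ Ioc A B, x / 2 < k * m ∧ l * m ≤ x) {y : ℝ} (hy : y ∈ Set.Icc (A + 1 : ℝ) B) :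
    x / 2 ≤ k * y ∧ l * y ≤ x := by
  have hlt : A < B := by exact_mod_cast (lt_add_one (A : ℝ)).trans_le (hy.1.trans hy.2)
  have hfirst := (hAB (A + 1) (mem_Ioc.2 ⟨by omega, hlt⟩)).1
  have hlast := (hAB B (mem_Ioc.2 ⟨hlt, le_rfl⟩)).2
  push_cast at hfirst
  exact ⟨hfirst.le.trans (mul_le_mul_of_nonneg_left hy.1 hk),
    (mul_le_mul_of_nonneg_left hy.2 hl).trans hlast⟩

theorem natCast_sub_le_div {x t l : ℝ} (hx : 0 ≤ x) (ht : 0 < t) (htl : t ≤ l) {A B : ℕ}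
    (hAB : ∀ m ∈ Ioc A B, l * m ≤ x) : ((B - A : ℕ) : ℝ) ≤ x / t := by
  rcases Nat.lt_or_ge A B with hlt | hge
  · calc ((B - A : ℕ) : ℝ) ≤ B := by exact_mod_cast Nat.sub_le B A
      _ ≤ x / l := by
          rw [le_div_iff₀ (ht.trans_le htl), mul_comm]
          exact hAB B (mem_Ioc.2 ⟨hlt, le_rfl⟩)
      _ ≤ x / t := by gcongr
  · rw [Nat.sub_eq_zero_of_le hge, Nat.cast_zero]
    positivity

end DyadicSums

section PiatetskiShapiroPhase

open Finset

/-- The phase `θ u - κ (u - β) ^ γ`. With `κ = h α ^ (-γ)` the second term is `h` times the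
inverse function of `n ↦ α n ^ c + β`; the linear term `θ u` detects a residue class. -/
noncomputable def psPhase (κ β γ θ u : ℝ) : ℝ := θ * u - κ * (u - β) ^ γ

theorem hasDerivAt_psPhase_mul (κ γ θ l : ℝ) {β y : ℝ} (hy : β < l * y) :
    HasDerivAt (fun y => psPhase κ β γ θ (l * y))
      (l * (θ - κ * (γ * (l * y - β) ^ (γ - 1)))) y := by
  have hlin : HasDerivAt (fun y => l * y) l y := by simpa using (hasDerivAt_id y).const_mul l
  have hpow := (hlin.sub_const β).rpow_const (p := γ) (.inl (sub_pos.2 hy).ne')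
  convert! (hlin.const_mul θ).sub (hpow.const_mul κ) using 1
  ring

theorem hasDerivAt_deriv_psPhase_mul (κ γ θ l : ℝ) {β y : ℝ} (hy : β < l * y) :
    HasDerivAt (fun y => l * (θ - κ * (γ * (l * y - β) ^ (γ - 1))))
      (κ * (γ * (1 - γ)) * (l ^ 2 * (l * y - β) ^ (γ - 2))) y := by
  have hlin : HasDerivAt (fun y => l * y) l y := by simpa using (hasDerivAt_id y).const_mul l
  have hpow := (hlin.sub_const β).rpow_const (p := γ - 1) (.inl (sub_pos.2 hy).ne')
  convert! (((hpow.const_mul γ).const_mul κ).const_sub θ).const_mul l using 1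
  rw [show γ - 1 - 1 = γ - 2 by ring]
  ring

theorem rpow_le_pow_mul_rpow {x v k e : ℝ} {n : ℕ} (he : e ≤ 0) (hn : -n ≤ e) (hk : 1 ≤ k)
    (hx : 0 < x) (hv : x ≤ k * v) : v ^ e ≤ k ^ n * x ^ e := by
  have hk₀ : 0 < k := by linarith
  have hv₀ : 0 < v := pos_of_mul_pos_right (hx.trans_le hv) hk₀.le
  calc v ^ e = k ^ (-e) * (k * v) ^ e := by
        rw [Real.mul_rpow hk₀.le hv₀.le, ← mul_assoc, ← Real.rpow_add hk₀, neg_add_cancel,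
          Real.rpow_zero, one_mul]
    _ ≤ k ^ (n : ℝ) * x ^ e :=
        mul_le_mul (Real.rpow_le_rpow_of_exponent_le hk (by linarith))
          (Real.rpow_le_rpow_of_nonpos hx hv he) (by positivity) (by positivity)
    _ = _ := by rw [Real.rpow_natCast]

theorem sub_rpow_mem_Icc {γ β x u : ℝ} (hγ₀ : 0 ≤ γ) (hγ₁ : γ ≤ 1) (hx : 0 < x)
    (hβ : |β| ≤ x / 8) (hu₁ : x / 2 ≤ u) (hu₂ : u ≤ x) :
    (u - β) ^ (γ - 2) ∈ Set.Icc (x ^ (γ - 2) / 4) (16 * x ^ (γ - 2)) := by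
  obtain ⟨hβ₁, hβ₂⟩ := abs_le.1 hβ
  have hlow : x ^ (γ - 2) ≤ 2 ^ 2 * (u - β) ^ (γ - 2) :=
    rpow_le_pow_mul_rpow (by linarith) (by push_cast; linarith) one_le_two (by linarith)
      (by linarith)
  have hupp : (u - β) ^ (γ - 2) ≤ 4 ^ 2 * x ^ (γ - 2) :=
    rpow_le_pow_mul_rpow (by linarith) (by push_cast; linarith) (by norm_num) hx (by linarith)
  constructor <;> linarith

theorem vanDerCorput_second_deriv_rpow {f f' f'' : ℝ → ℝ} {A B : ℕ} {γ lam M t x : ℝ}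
    (hlam : 0 < lam) (hM : 1 ≤ M) (hx : 0 < x) (hN : ((B - A : ℕ) : ℝ) ≤ x / t)
    (hf : ∀ y ∈ Set.Icc (A + 1 : ℝ) B, HasDerivAt f (f' y) y)
    (hf' : ∀ y ∈ Set.Icc (A + 1 : ℝ) B, HasDerivAt f' (f'' y) y)
    (hf'' : ∀ y ∈ Set.Icc (A + 1 : ℝ) B,
      f'' y ∈ Set.Icc (lam * x ^ (γ - 2)) (M * (lam * x ^ (γ - 2)))) :
    ‖∑ n ∈ Ioc A B, unitExp (f n)‖ ≤
      4 * M * √lam / t * x ^ (γ / 2) + 9 / √lam * x ^ (1 - γ / 2) := by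
  have hsqrt : √(lam * x ^ (γ - 2)) = √lam * (x ^ (γ / 2) / x) := by
    rw [Real.sqrt_mul hlam.le, Real.sqrt_eq_rpow (x ^ _), ← Real.rpow_mul hx.le,
      ← Real.rpow_sub_one hx.ne']
    ring_nf
  calc _ ≤ 4 * M * (B - A : ℕ) * √(lam * x ^ (γ - 2)) + 9 / √(lam * x ^ (γ - 2)) :=
        vanDerCorput_second_deriv (by positivity) hM hf hf' hf''
    _ ≤ 4 * M * (x / t) * √(lam * x ^ (γ - 2)) + 9 / √(lam * x ^ (γ - 2)) := by gcongr
    _ = _ := by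
        have : 0 < √lam := Real.sqrt_pos.2 hlam
        rw [hsqrt, Real.rpow_sub hx, Real.rpow_one]
        field_simp

variable {γ β κ θ x : ℝ}

theorem norm_sum_unitExp_psPhase_mul_le (hγ₀ : 0 < γ) (hγ₁ : γ < 1) (hκ : 0 < κ) (hx : 0 < x)
    (hβ : |β| ≤ x / 8) {d A B : ℕ} (hd : 1 ≤ d)
    (hAB : ∀ m ∈ Ioc A B, x / 2 < d * m ∧ (d : ℝ) * m ≤ x) :
    ‖∑ m ∈ Ioc A B, unitExp (psPhase κ β γ θ (d * m))‖ ≤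
      128 / √(γ * (1 - γ)) * (√κ * x ^ (γ / 2) + x ^ (1 - γ / 2) / √κ) := by
  have hc₀ : 0 < γ * (1 - γ) := mul_pos hγ₀ (by linarith)
  have hc₁ : √(γ * (1 - γ)) ≤ 1 := Real.sqrt_le_one.2 (by nlinarith)
  set c := γ * (1 - γ)
  have hsc := Real.sqrt_pos.2 hc₀
  have := Real.sqrt_pos.2 hκ
  have hd₁ : (1 : ℝ) ≤ d := by exact_mod_cast hd
  have hwin := fun y hy => half_le_mul_and_mul_le d.cast_nonneg d.cast_nonneg hAB (y := y) hy
  have hdom : ∀ y ∈ Set.Icc (A + 1 : ℝ) B, β < d * y := fun y hy => by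
    linarith [(hwin y hy).1, (abs_le.1 hβ).2]
  have hsqrt : √(κ * c * d ^ 2 / 4) = √κ * √c * d / 2 := by
    rw [show κ * c * d ^ 2 / 4 = κ * c * (d / 2) ^ 2 by ring, Real.sqrt_mul (by positivity),
      Real.sqrt_mul hκ.le, Real.sqrt_sq (by positivity)]
    ring
  have hsum := vanDerCorput_second_deriv_rpow (lam := κ * c * d ^ 2 / 4) (M := 64)
    (by positivity) (by norm_num) hx
    (natCast_sub_le_div hx.le (by linarith) le_rfl fun m hm => (hAB m hm).2)
    (fun y hy => hasDerivAt_psPhase_mul κ γ θ d (hdom y hy))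
    (fun y hy => hasDerivAt_deriv_psPhase_mul κ γ θ d (hdom y hy)) fun y hy => by
      obtain ⟨hlow, hupp⟩ := sub_rpow_mem_Icc hγ₀.le hγ₁.le hx hβ (hwin y hy).1 (hwin y hy).2
      constructor
      · calc _ = κ * c * (d ^ 2 * (x ^ (γ - 2) / 4)) := by ring
          _ ≤ _ := by gcongr
      · calc _ ≤ κ * c * (d ^ 2 * (16 * x ^ (γ - 2))) := by gcongr
          _ = _ := by ring
  calc _ ≤ _ := hsum
    _ = 128 * √c * (√κ * x ^ (γ / 2)) + 18 / (√c * d) * (x ^ (1 - γ / 2) / √κ) := by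
        rw [hsqrt]; field_simp; ring
    _ ≤ 128 / √c * (√κ * x ^ (γ / 2)) + 128 / √c * (x ^ (1 - γ / 2) / √κ) := by
        gcongr
        · rw [le_div_iff₀ hsc]; nlinarith
        · norm_num
        · nlinarith
    _ = _ := by ring

end PiatetskiShapiroPhase

section TypeI

open Finset

theorem norm_sum_monotone_mul_le {w : ℕ → ℝ} (hw : Monotone w) (hw₀ : 0 ≤ w 0) {z : ℕ → ℂ}
    {A B : ℕ} {R : ℝ} (hR : ∀ C ≤ B, ‖∑ n ∈ Ioc A C, z n‖ ≤ R) :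
    ‖∑ n ∈ Ioc A B, (w n : ℂ) * z n‖ ≤ 2 * w B * R := by
  have hR₀ : 0 ≤ R := (norm_nonneg _).trans (hR B le_rfl)
  have hw_nonneg : ∀ n, 0 ≤ w n := fun n => hw₀.trans (hw n.zero_le)
  rcases Nat.lt_or_ge B A with h | h
  · rw [Ioc_eq_empty_of_le h.le, sum_empty, norm_zero]
    have := hw_nonneg B
    positivity
  have habel : ∀ C, A ≤ C → C ≤ B →
      ‖∑ n ∈ Ioc A C, (w n : ℂ) * z n - w C * ∑ n ∈ Ioc A C, z n‖ ≤ (w C - w A) * R := by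
    intro C hAC
    induction C, hAC using Nat.le_induction with
    | base => simp
    | succ C hAC ih =>
      intro hCB
      have hstep : 0 ≤ w (C + 1) - w C := sub_nonneg.2 (hw C.le_succ)
      rw [sum_Ioc_succ_top (by omega), sum_Ioc_succ_top (by omega)]
      calc _ = ‖(∑ n ∈ Ioc A C, (w n : ℂ) * z n - w C * ∑ n ∈ Ioc A C, z n) -
              ((w (C + 1) - w C : ℝ) : ℂ) * ∑ n ∈ Ioc A C, z n‖ := by
            push_cast; ring_nf
        _ ≤ (w C - w A) * R + (w (C + 1) - w C) * R := by
            refine (norm_sub_le _ _).trans (add_le_add (ih (by omega)) ?_)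
            rw [norm_mul, Complex.norm_of_nonneg hstep]
            exact mul_le_mul_of_nonneg_left (hR C (by omega)) hstep
        _ = _ := by ring
  calc _ ≤ ‖∑ n ∈ Ioc A B, (w n : ℂ) * z n - w B * ∑ n ∈ Ioc A B, z n‖ +
          ‖(w B : ℂ) * ∑ n ∈ Ioc A B, z n‖ := norm_le_norm_sub_add _ _
    _ ≤ (w B - w A) * R + w B * R := by
        rw [norm_mul, Complex.norm_of_nonneg (hw_nonneg B)]
        exact add_le_add (habel B h le_rfl) (mul_le_mul_of_nonneg_left (hR B le_rfl) (hw_nonneg B))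
    _ ≤ _ := by nlinarith [mul_nonneg (hw_nonneg A) hR₀]

theorem norm_sum_Ioc_mul_le_of_eq_zero {c : ℕ → ℝ} {g : ℕ → ℂ} {N : ℕ} {D L S : ℝ} (hD : 0 ≤ D)
    (hL : 0 ≤ L) (hS : 0 ≤ S) (hcD : ∀ d : ℕ, D < d → c d = 0) (hcL : ∀ d ∈ Ioc 0 N, |c d| ≤ L)
    (hg : ∀ d ∈ Ioc 0 N, ‖g d‖ ≤ S) : ‖∑ d ∈ Ioc 0 N, (c d : ℂ) * g d‖ ≤ D * L * S := by
  have hterm : ∀ d ∈ Ioc 0 N, ‖(c d : ℂ) * g d‖ ≤ if d ≤ ⌊D⌋₊ then L * S else 0 := by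
    intro d hd
    split_ifs with h
    · rw [norm_mul, Complex.norm_real]
      exact mul_le_mul (hcL d hd) (hg d hd) (norm_nonneg _) hL
    · rw [hcD d ((Nat.floor_lt hD).1 (not_le.1 h)), Complex.ofReal_zero, zero_mul, norm_zero]
  have hcard : ((Ioc 0 N).filter (· ≤ ⌊D⌋₊)).card ≤ ⌊D⌋₊ := by
    simpa using card_le_card (t := Ioc 0 ⌊D⌋₊) fun d hd => by
      rw [mem_filter, mem_Ioc] at hd
      exact mem_Ioc.2 ⟨hd.1.1, hd.2⟩
  calc _ ≤ ∑ d ∈ Ioc 0 N, if d ≤ ⌊D⌋₊ then L * S else 0 := norm_sum_le_of_le _ hterm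
    _ = ((Ioc 0 N).filter (· ≤ ⌊D⌋₊)).card * (L * S) := by
        rw [← sum_filter, sum_const, nsmul_eq_mul]
    _ ≤ D * (L * S) := by
        gcongr
        exact (Nat.cast_le.2 hcard).trans (Nat.floor_le hD)
    _ = _ := by ring

variable {γ β κ θ x : ℝ}

theorem norm_sum_monotone_mul_dyadicExp_le (hγ₀ : 0 < γ) (hγ₁ : γ < 1) (hκ : 0 < κ) (hx : 0 < x)
    (hβ : |β| ≤ x / 8) {w : ℕ → ℝ} (hw : Monotone w) (hw₀ : 0 ≤ w 0) {d : ℕ} (hd : 1 ≤ d) :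
    ‖∑ m ∈ Ioc 0 ⌊x⌋₊, (w m : ℂ) * dyadicExp (psPhase κ β γ θ) x (d * m)‖ ≤
      w ⌊x⌋₊ * (256 / √(γ * (1 - γ)) * (√κ * x ^ (γ / 2) + x ^ (1 - γ / 2) / √κ)) := by
  have hd₁ : (1 : ℝ) ≤ d := by exact_mod_cast hd
  have hd₀ : (0 : ℝ) < d := by linarith
  set R := 128 / √(γ * (1 - γ)) * (√κ * x ^ (γ / 2) + x ^ (1 - γ / 2) / √κ) with hR
  rw [sum_dyadicExp_mul_eq _ hx.le hd fun m => (w m : ℂ)]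
  calc _ ≤ 2 * w ⌊x / d⌋₊ * R := by
        refine norm_sum_monotone_mul_le hw hw₀ fun C hC =>
          norm_sum_unitExp_psPhase_mul_le hγ₀ hγ₁ hκ hx hβ hd fun m hm => ?_
        exact (mem_Ioc_floor_div_iff hx.le hd₀ hd₀ m).1 (Ioc_subset_Ioc_right hC hm)
    _ ≤ 2 * w ⌊x⌋₊ * R := by
        gcongr
        exact hw (Nat.floor_mono (div_le_self hx.le hd₁))
    _ = _ := by rw [hR]; ring

theorem typeIBound_dyadicExp_psPhase (hγ₀ : 0 < γ) (hγ₁ : γ < 1) (hκ : 0 < κ) (hx : 0 < x)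
    (hβ : |β| ≤ x / 8) :
    TypeIBound (dyadicExp (psPhase κ β γ θ) x) ⌊x⌋₊
      (256 / √(γ * (1 - γ)) * (√κ * x ^ (γ / 2) + x ^ (1 - γ / 2) / √κ)) := by
  intro c w D L hw hw₀ hD hL hcD hcL
  have hw_nonneg : 0 ≤ w ⌊x⌋₊ := hw₀.trans (hw (Nat.zero_le _))
  simp_rw [mul_assoc (c _ : ℂ), ← mul_sum]
  exact norm_sum_Ioc_mul_le_of_eq_zero hD hL (by positivity) hcD hcL fun d hd =>
    norm_sum_monotone_mul_dyadicExp_le hγ₀ hγ₁ hκ hx hβ hw hw₀ (mem_Ioc.1 hd).1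

end TypeI

section TypeII

open Finset ComplexConjugate

theorem hasDerivAt_sq_mul_sub_rpow (γ : ℝ) {β u : ℝ} (hu : β < u) :
    HasDerivAt (fun u : ℝ => u ^ 2 * (u - β) ^ (γ - 2))
      (u * (γ * u - 2 * β) * (u - β) ^ (γ - 3)) u := by
  have hpos : 0 < u - β := sub_pos.2 hu
  have hpow := ((hasDerivAt_id u).sub_const β).rpow_const (p := γ - 2) (.inl hpos.ne')
  convert! (hasDerivAt_pow 2 u).mul hpow using 1
  have hsplit : (u - β) ^ (γ - 2) = (u - β) ^ (γ - 3) * (u - β) := by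
    rw [← Real.rpow_add_one hpos.ne']
    ring_nf
  simp only [id]
  rw [hsplit, show γ - 2 - 1 = γ - 3 by ring]
  push_cast
  ring

theorem mul_sub_rpow_mem_Icc {γ β x u : ℝ} (hγ₀ : 3 / 4 ≤ γ) (hγ₁ : γ ≤ 1) (hx : 0 < x)
    (hβ : |β| ≤ x / 8) (hu₁ : x / 2 ≤ u) (hu₂ : u ≤ x) :
    u * (γ * u - 2 * β) * (u - β) ^ (γ - 3) ∈
      Set.Icc (x ^ (γ - 1) / 36) (24 * x ^ (γ - 1)) := by
  obtain ⟨hβ₁, hβ₂⟩ := abs_le.1 hβ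
  have hlow : x ^ (γ - 3) ≤ (9 / 8) ^ 3 * (u - β) ^ (γ - 3) :=
    rpow_le_pow_mul_rpow (by linarith) (by push_cast; linarith) (by norm_num) (by linarith)
      (by linarith)
  have hupp : (u - β) ^ (γ - 3) ≤ (8 / 3) ^ 3 * x ^ (γ - 3) :=
    rpow_le_pow_mul_rpow (by linarith) (by push_cast; linarith) (by norm_num) hx (by linarith)
  have : 0 < x ^ (γ - 3) := by positivity
  have hfac_low : x / 8 ≤ γ * u - 2 * β := by nlinarith
  have hfac_upp : γ * u - 2 * β ≤ 5 / 4 * x := by nlinarith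
  have hsplit : x ^ (γ - 1) = x ^ 2 * x ^ (γ - 3) := by
    rw [← Real.rpow_natCast, ← Real.rpow_add hx]
    norm_num
    ring_nf
  rw [hsplit]
  have hu₀ : 0 ≤ u := by linarith
  have hfac₀ : 0 ≤ γ * u - 2 * β := by linarith
  have hpos : 0 < x ^ 2 * x ^ (γ - 3) := by positivity
  constructor
  · calc x ^ 2 * x ^ (γ - 3) / 36 ≤ x / 2 * (x / 8) * (x ^ (γ - 3) / (9 / 8) ^ 3) := by
          linear_combination (32 / 729 - 1 / 36) * hpos.le
      _ ≤ u * (γ * u - 2 * β) * (u - β) ^ (γ - 3) :=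
          mul_le_mul (by gcongr) ((div_le_iff₀' (by norm_num)).2 hlow) (by positivity)
            (by positivity)
  · calc _ ≤ x * (5 / 4 * x) * ((8 / 3) ^ 3 * x ^ (γ - 3)) :=
          mul_le_mul (by gcongr) hupp (Real.rpow_nonneg (by linarith) _) (by positivity)
      _ ≤ _ := by linear_combination (24 - 5 / 4 * (8 / 3) ^ 3) * hpos.le

theorem sq_mul_rpow_sub_sq_mul_rpow_mem_Icc {γ β x l₁ l₂ t y : ℝ} (hγ₀ : 3 / 4 ≤ γ) (hγ₁ : γ ≤ 1)
    (hx : 0 < x) (hβ : |β| ≤ x / 8) (ht : 0 < t) (htl : t ≤ l₁) (hl : l₁ < l₂)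
    (hlt : l₂ ≤ 2 * t) (hy₁ : x / 2 ≤ l₁ * y) (hy₂ : l₂ * y ≤ x) :
    l₂ ^ 2 * (l₂ * y - β) ^ (γ - 2) - l₁ ^ 2 * (l₁ * y - β) ^ (γ - 2) ∈
      Set.Icc ((l₂ - l₁) * t / 36 * x ^ (γ - 2)) (96 * (l₂ - l₁) * t * x ^ (γ - 2)) := by
  have hy : 0 < y := pos_of_mul_pos_right (by linarith : 0 < l₁ * y) (by linarith)
  have hD : 0 < l₂ - l₁ := sub_pos.2 hl
  have hdom : ∀ u, l₁ * y ≤ u → β < u := fun u hu => by linarith [(abs_le.1 hβ).2]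
  obtain ⟨ξ, ⟨hξ₁, hξ₂⟩, hξ⟩ := exists_hasDerivAt_eq_slope
    (fun u : ℝ => u ^ 2 * (u - β) ^ (γ - 2)) _ (mul_lt_mul_of_pos_right hl hy)
    (fun u hu => (hasDerivAt_sq_mul_sub_rpow γ (hdom u hu.1)).continuousAt.continuousWithinAt)
    fun u hu => hasDerivAt_sq_mul_sub_rpow γ (hdom u hu.1.le)
  have hψ := mul_sub_rpow_mem_Icc hγ₀ hγ₁ hx hβ (hy₁.trans hξ₁.le) (hξ₂.le.trans hy₂)
  set ψ := ξ * (γ * ξ - 2 * β) * (ξ - β) ^ (γ - 3)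
  have hψ₀ : 0 ≤ ψ := (by positivity : 0 ≤ x ^ (γ - 1) / 36).trans hψ.1
  have hslope : l₂ ^ 2 * (l₂ * y - β) ^ (γ - 2) - l₁ ^ 2 * (l₁ * y - β) ^ (γ - 2) =
      (l₂ - l₁) * (ψ / y) := by
    rw [hξ]
    field_simp
  have hpow : x ^ (γ - 1) = x ^ (γ - 2) * x := by
    rw [← Real.rpow_add_one hx.ne']
    ring_nf
  have hy_upp : y ≤ x / t := by rw [le_div_iff₀ ht]; nlinarith
  have hy_low : x / (4 * t) ≤ y := by rw [div_le_iff₀ (by positivity)]; nlinarith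
  rw [hslope]
  constructor
  · calc _ = (l₂ - l₁) * (x ^ (γ - 1) / 36 / (x / t)) := by rw [hpow]; field_simp
      _ ≤ _ := by gcongr; exact hψ.1
  · calc (l₂ - l₁) * (ψ / y) ≤ (l₂ - l₁) * (24 * x ^ (γ - 1) / (x / (4 * t))) := by
          gcongr; exact hψ.2
      _ = _ := by rw [hpow]; field_simp; norm_num

theorem correlation_size_le {c κ D Q t X Y : ℝ} (hc₀ : 0 < c) (hc₁ : c ≤ 1) (hκ : 0 < κ)
    (hD : 1 ≤ D) (hDQ : D ≤ Q) (ht : 0 < t) (hX : 0 ≤ X) (hY : 0 ≤ Y) :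
    4 * 3456 * √(κ * c * D * t / 36) / t * X + 9 / √(κ * c * D * t / 36) * Y ≤
      2304 / √c * (√κ * √Q * X + Y / √κ) / √t := by
  have hD₀ : 0 < D := by linarith
  have hsc := Real.sqrt_pos.2 hc₀
  have hsc₁ : √c ≤ 1 := Real.sqrt_le_one.2 hc₁
  have := Real.sqrt_pos.2 hκ
  have hst := Real.sqrt_pos.2 ht
  have := Real.sqrt_pos.2 hD₀
  have hsD₁ : 1 ≤ √D := Real.one_le_sqrt.2 hD
  have hsqrt : √(κ * c * D * t / 36) = √κ * √c * √D * √t / 6 := by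
    rw [Real.sqrt_div' _ (by norm_num), Real.sqrt_mul (by positivity),
      Real.sqrt_mul (by positivity), Real.sqrt_mul hκ.le, show (36 : ℝ) = 6 ^ 2 by norm_num,
      Real.sqrt_sq (by norm_num)]
  calc _ = (2304 * √c * (√κ * √D * X) + 54 / (√c * √D) * (Y / √κ)) / √t := by
        rw [hsqrt, add_div]
        congr 1
        · rw [eq_div_iff hst.ne']
          field_simp
          rw [Real.sq_sqrt ht.le]
          ring
        · field_simp
          ring
    _ ≤ (2304 / √c * (√κ * √Q * X) + 2304 / √c * (Y / √κ)) / √t := by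
        gcongr
        · rw [le_div_iff₀ hsc]; nlinarith
        · norm_num
        · nlinarith
    _ = _ := by ring

section Correlation

variable {γ β κ θ x : ℝ} {t Q l₁ l₂ : ℕ}

theorem norm_sum_unitExp_psPhase_sub_le (hγ₀ : 3 / 4 ≤ γ) (hγ₁ : γ < 1) (hκ : 0 < κ) (hx : 0 < x)
    (hβ : |β| ≤ x / 8) (ht : 1 ≤ t) (htl : t ≤ l₁) (hl : l₁ < l₂) (hlt : l₂ ≤ 2 * t)
    (hlQ : l₂ ≤ l₁ + Q) {A B : ℕ} (hAB : ∀ m ∈ Ioc A B, x / 2 < l₁ * m ∧ (l₂ : ℝ) * m ≤ x) :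
    ‖∑ m ∈ Ioc A B, unitExp (psPhase κ β γ θ (l₂ * m) - psPhase κ β γ θ (l₁ * m))‖ ≤
      2304 / √(γ * (1 - γ)) * (√κ * √Q * x ^ (γ / 2) + x ^ (1 - γ / 2) / √κ) / √t := by
  have hc₀ : 0 < γ * (1 - γ) := mul_pos (by linarith) (by linarith)
  have hc₁ : γ * (1 - γ) ≤ 1 := by nlinarith
  set c := γ * (1 - γ)
  have ht₀ : (0 : ℝ) < t := by exact_mod_cast ht
  have htl' : (t : ℝ) ≤ l₁ := by exact_mod_cast htl
  have hl' : (l₁ : ℝ) + 1 ≤ l₂ := by exact_mod_cast hl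
  have hlt' : (l₂ : ℝ) ≤ 2 * t := by exact_mod_cast hlt
  set D : ℝ := l₂ - l₁
  have hDQ : D ≤ Q := sub_le_iff_le_add'.2 (by exact_mod_cast hlQ)
  have hwin := fun y hy => half_le_mul_and_mul_le l₁.cast_nonneg l₂.cast_nonneg hAB (y := y) hy
  have hdom₁ : ∀ y ∈ Set.Icc (A + 1 : ℝ) B, β < l₁ * y := fun y hy => by
    linarith [(hwin y hy).1, (abs_le.1 hβ).2]
  have hdom₂ : ∀ y ∈ Set.Icc (A + 1 : ℝ) B, β < l₂ * y := fun y hy => by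
    have hy₀ : 0 ≤ y := (by positivity : (0 : ℝ) ≤ A + 1).trans hy.1
    nlinarith [hdom₁ y hy]
  have hD₀ : 0 < D := by linarith
  have hsum := vanDerCorput_second_deriv_rpow (lam := κ * c * D * t / 36) (M := 3456)
    (by positivity) (by norm_num) hx
    (natCast_sub_le_div hx.le ht₀ (by linarith) fun m hm => (hAB m hm).2)
    (fun y hy => (hasDerivAt_psPhase_mul κ γ θ l₂ (hdom₂ y hy)).sub
      (hasDerivAt_psPhase_mul κ γ θ l₁ (hdom₁ y hy)))
    (fun y hy => (hasDerivAt_deriv_psPhase_mul κ γ θ l₂ (hdom₂ y hy)).sub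
      (hasDerivAt_deriv_psPhase_mul κ γ θ l₁ (hdom₁ y hy))) fun y hy => by
      obtain ⟨hlow, hupp⟩ := sq_mul_rpow_sub_sq_mul_rpow_mem_Icc hγ₀ hγ₁.le hx hβ ht₀ htl'
        (by linarith) hlt' (hwin y hy).1 (hwin y hy).2
      have hκc : 0 ≤ κ * c := by positivity
      rw [← mul_sub]
      constructor
      · calc _ = κ * c * ((l₂ - l₁) * t / 36 * x ^ (γ - 2)) := by ring
          _ ≤ _ := mul_le_mul_of_nonneg_left hlow hκc
      · calc _ ≤ κ * c * (96 * (l₂ - l₁) * t * x ^ (γ - 2)) := mul_le_mul_of_nonneg_left hupp hκc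
          _ = _ := by ring
  exact hsum.trans (correlation_size_le hc₀ hc₁ hκ (by linarith) hDQ ht₀
    (by positivity) (by positivity))

theorem norm_sum_dyadicExp_mul_conj_le (hγ₀ : 3 / 4 ≤ γ) (hγ₁ : γ < 1) (hκ : 0 < κ) (hx : 0 < x)
    (hβ : |β| ≤ x / 8) (ht : 1 ≤ t) (htl : t ≤ l₁) (hl : l₁ < l₂) (hlt : l₂ ≤ 2 * t)
    (hlQ : l₂ ≤ l₁ + Q) {N : ℕ} (hN : ⌊x / l₂⌋₊ ≤ N) :
    ‖∑ m ∈ Ioc 0 N, dyadicExp (psPhase κ β γ θ) x (l₂ * m) *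
        conj (dyadicExp (psPhase κ β γ θ) x (l₁ * m))‖ ≤
      2304 / √(γ * (1 - γ)) * (√κ * √Q * x ^ (γ / 2) + x ^ (1 - γ / 2) / √κ) / √t := by
  have hl₁ : 1 ≤ l₁ := ht.trans htl
  have hl₂ : 1 ≤ l₂ := hl₁.trans hl.le
  rw [sum_dyadicExp_mul_conj_eq _ hx.le hl₁ hl.le hN]
  exact norm_sum_unitExp_psPhase_sub_le hγ₀ hγ₁ hκ hx hβ ht htl hl hlt hlQ fun m hm =>
    (mem_Ioc_floor_div_iff hx.le (by exact_mod_cast hl₁) (by exact_mod_cast hl₂) m).1 hm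

end Correlation

section Bilinear

variable {ι τ : Type*} {s : Finset ι} {r : Finset τ} {a : ι → ℂ} {F : ι → τ → ℂ} {A P : ℝ}

theorem sum_norm_sq_sum_mul_eq (s : Finset ι) (r : Finset τ) (a : ι → ℂ) (F : ι → τ → ℂ) :
    ((∑ m ∈ r, ‖∑ l ∈ s, a l * F l m‖ ^ 2 : ℝ) : ℂ) =
      ∑ l ∈ s, ∑ l' ∈ s, a l * conj (a l') * ∑ m ∈ r, F l m * conj (F l' m) := by
  push_cast
  simp_rw [← Complex.mul_conj', map_sum, sum_mul_sum, mul_sum]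
  rw [sum_comm]
  refine sum_congr rfl fun l _ => ?_
  rw [sum_comm]
  refine sum_congr rfl fun l' _ => sum_congr rfl fun m _ => ?_
  rw [map_mul]
  ring

theorem sum_norm_sq_sum_mul_le (hA : ∀ l ∈ s, ‖a l‖ ≤ A) (hP : 0 ≤ P)
    (hF : ∀ l m, ‖F l m‖ ≤ 1)
    (hoff : ∀ l ∈ s, ∀ l' ∈ s, l ≠ l' → ‖∑ m ∈ r, F l m * conj (F l' m)‖ ≤ P) :
    ∑ m ∈ r, ‖∑ l ∈ s, a l * F l m‖ ^ 2 ≤ A ^ 2 * (#s * #r + #s ^ 2 * P) := by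
  classical
  have hdiag : ∀ l, ‖∑ m ∈ r, F l m * conj (F l m)‖ ≤ #r := fun l => by
    simpa using norm_sum_le_of_le r (n := fun _ => 1) fun m _ => by
      rw [norm_mul, RCLike.norm_conj]
      exact mul_le_one₀ (hF l m) (norm_nonneg _) (hF l m)
  have hpair : ∀ l ∈ s, ∀ l' ∈ s, ‖a l * conj (a l') * ∑ m ∈ r, F l m * conj (F l' m)‖ ≤
      A ^ 2 * ((if l = l' then (#r : ℝ) else 0) + P) := fun l hl l' hl' => by
    rw [norm_mul, norm_mul, RCLike.norm_conj, sq]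
    have hA₀ : 0 ≤ A := (norm_nonneg _).trans (hA l hl)
    gcongr
    · exact hA l hl
    · exact hA l' hl'
    split_ifs with h
    · exact h ▸ (hdiag l).trans (le_add_of_nonneg_right hP)
    · simpa using hoff l hl l' hl' h
  calc _ = ‖((∑ m ∈ r, ‖∑ l ∈ s, a l * F l m‖ ^ 2 : ℝ) : ℂ)‖ :=
        (Complex.norm_of_nonneg (by positivity)).symm
    _ ≤ ∑ l ∈ s, ∑ l' ∈ s, A ^ 2 * ((if l = l' then (#r : ℝ) else 0) + P) := by
        rw [sum_norm_sq_sum_mul_eq]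
        exact norm_sum_le_of_le _ fun l hl => norm_sum_le_of_le _ (hpair l hl)
    _ = _ := by
        simp_rw [← mul_sum, sum_add_distrib, sum_ite_eq, sum_ite_mem, inter_self, sum_const,
          nsmul_eq_mul]
        ring

theorem norm_sum_sum_mul_sq_le {b : τ → ℂ} {B : ℝ} (hA : ∀ l ∈ s, ‖a l‖ ≤ A)
    (hB : ∀ m ∈ r, ‖b m‖ ≤ B) (hP : 0 ≤ P) (hF : ∀ l m, ‖F l m‖ ≤ 1)
    (hoff : ∀ l ∈ s, ∀ l' ∈ s, l ≠ l' → ‖∑ m ∈ r, F l m * conj (F l' m)‖ ≤ P) :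
    ‖∑ l ∈ s, ∑ m ∈ r, a l * b m * F l m‖ ^ 2 ≤
      A ^ 2 * B ^ 2 * (#r * (#s * #r + #s ^ 2 * P)) := by
  have hswap : ∑ l ∈ s, ∑ m ∈ r, a l * b m * F l m = ∑ m ∈ r, b m * ∑ l ∈ s, a l * F l m := by
    rw [sum_comm]
    simp_rw [mul_sum]
    exact sum_congr rfl fun m _ => sum_congr rfl fun l _ => by ring
  calc _ ≤ (∑ m ∈ r, ‖b m‖ * ‖∑ l ∈ s, a l * F l m‖) ^ 2 := by
        rw [hswap]
        gcongr
        exact norm_sum_le_of_le _ fun m _ => norm_mul_le _ _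
    _ ≤ (∑ m ∈ r, ‖b m‖ ^ 2) * ∑ m ∈ r, ‖∑ l ∈ s, a l * F l m‖ ^ 2 :=
        sum_mul_sq_le_sq_mul_sq _ _ _
    _ ≤ (∑ _m ∈ r, B ^ 2) * (A ^ 2 * (#s * #r + #s ^ 2 * P)) := by
        gcongr
        · exact hB _ ‹_›
        · exact sum_norm_sq_sum_mul_le hA hP hF hoff
    _ = _ := by
        rw [sum_const, nsmul_eq_mul]
        ring

end Bilinear

section Blocks

variable {G : ℝ → ℝ} {x T P : ℝ} {Q : ℕ} {a b : ℕ → ℂ} {A B : ℝ}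

theorem sum_mul_dyadicExp_eq_sum_floor_div {t l : ℕ} (hx : 0 ≤ x) (ht : 1 ≤ t) (htl : t ≤ l)
    (w : ℕ → ℂ) :
    ∑ m ∈ Ioc 0 ⌊x⌋₊, w m * dyadicExp G x (l * m) =
      ∑ m ∈ Ioc 0 ⌊x / t⌋₊, w m * dyadicExp G x (l * m) := by
  have ht₀ : (0 : ℝ) < t := by exact_mod_cast ht
  have htl' : (t : ℝ) ≤ l := by exact_mod_cast htl
  have hfloor : ⌊x / t⌋₊ ≤ ⌊x⌋₊ := Nat.floor_mono (div_le_self hx (by exact_mod_cast ht))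
  refine (sum_subset (Ioc_subset_Ioc_right hfloor) fun m hm hm' => ?_).symm
  have hlarge : x / t < m := (Nat.floor_lt (by positivity)).1 <| by
    rw [mem_Ioc] at hm hm'
    omega
  rw [dyadicExp_eq_zero, mul_zero]
  rw [div_lt_iff₀ ht₀] at hlarge
  push_cast
  nlinarith [m.cast_nonneg (α := ℝ)]

theorem norm_sum_dyadicExp_block_sq_le {j : ℕ} (hx : 0 ≤ x) (hP : 0 ≤ P) (hQ : 1 ≤ Q)
    (hj : 1 ≤ j) (hA : ∀ l ∈ Ioc 0 ⌊x⌋₊, ‖a l‖ ≤ A) (hB : ∀ m ∈ Ioc 0 ⌊x⌋₊, ‖b m‖ ≤ B)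
    (hcorr : ∀ {l₁ l₂ N : ℕ}, j * Q ≤ l₁ → l₁ < l₂ → l₂ ≤ 2 * (j * Q) → l₂ ≤ l₁ + Q →
      ⌊x / l₂⌋₊ ≤ N → ‖∑ m ∈ Ioc 0 N, dyadicExp G x (l₂ * m) * conj (dyadicExp G x (l₁ * m))‖ ≤ P) :
    ‖∑ l ∈ Ioc 0 ⌊x⌋₊ with l / Q = j, ∑ m ∈ Ioc 0 ⌊x⌋₊, a l * b m * dyadicExp G x (l * m)‖ ^ 2 ≤
      A ^ 2 * B ^ 2 * (x / (j * Q) * (Q * (x / (j * Q)) + Q ^ 2 * P)) := by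
  set t := j * Q with ht
  have ht₁ : 1 ≤ t := Nat.mul_pos hj hQ
  have ht₀ : (0 : ℝ) < t := by exact_mod_cast ht₁
  have hQt : Q ≤ t := Nat.le_mul_of_pos_left Q hj
  set s := (Ioc 0 ⌊x⌋₊).filter (· / Q = j)
  have hs : ∀ l ∈ s, l ∈ Ioc 0 ⌊x⌋₊ ∧ t ≤ l ∧ l < t + Q := fun l hl => by
    obtain ⟨hlx, hlj⟩ := mem_filter.1 hl
    have := (Nat.div_eq_iff (by omega : 0 < Q)).1 hlj
    exact ⟨hlx, by omega, by omega⟩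
  have hcard : #s ≤ Q := by
    simpa using card_le_card (t := Ico t (t + Q)) fun l hl => mem_Ico.2 (hs l hl).2
  have hNx : ⌊x / t⌋₊ ≤ ⌊x⌋₊ := Nat.floor_mono (div_le_self hx (by exact_mod_cast ht₁))
  have hoff : ∀ l ∈ s, ∀ l' ∈ s, l < l' → ‖∑ m ∈ Ioc 0 ⌊x / t⌋₊,
      dyadicExp G x (l' * m) * conj (dyadicExp G x (l * m))‖ ≤ P := fun l hl l' hl' hlt => by
    obtain ⟨-, hl₁, -⟩ := hs l hl
    obtain ⟨-, hl₁', hl₂'⟩ := hs l' hl'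
    refine hcorr hl₁ hlt (by omega) (by omega) (Nat.floor_mono ?_)
    gcongr
  have hbilinear := norm_sum_sum_mul_sq_le (F := fun l m => dyadicExp G x (l * m))
    (r := Ioc 0 ⌊x / t⌋₊) (fun l hl => hA l (hs l hl).1)
    (fun m hm => hB m (Ioc_subset_Ioc_right hNx hm)) hP (fun l m => norm_dyadicExp_le G x (l * m))
    fun l hl l' hl' hne => by
      rcases lt_or_gt_of_ne hne with h | h
      · rw [← RCLike.norm_conj, map_sum]
        simpa [mul_comm] using hoff l hl l' hl' h
      · exact hoff l' hl' l hl h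
  rw [sum_congr rfl fun l hl =>
    sum_mul_dyadicExp_eq_sum_floor_div hx ht₁ (hs l hl).2.1 fun m => a l * b m]
  refine hbilinear.trans ?_
  have htQ : (j : ℝ) * Q = t := by rw [ht, Nat.cast_mul]
  rw [Nat.card_Ioc, Nat.sub_zero, htQ]
  gcongr <;> exact Nat.floor_le (by positivity)

theorem norm_sum_dyadicExp_block_le {j : ℕ} (hx : 0 ≤ x) (hP : 0 ≤ P) (hQ : 1 ≤ Q)
    (hj : 1 ≤ j) (hT : ((j * Q : ℕ) : ℝ) ≤ T) (hA₀ : 0 ≤ A) (hB₀ : 0 ≤ B)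
    (hA : ∀ l ∈ Ioc 0 ⌊x⌋₊, ‖a l‖ ≤ A) (hB : ∀ m ∈ Ioc 0 ⌊x⌋₊, ‖b m‖ ≤ B)
    (hcorr : ∀ {l₁ l₂ N : ℕ}, j * Q ≤ l₁ → l₁ < l₂ → l₂ ≤ 2 * (j * Q) → l₂ ≤ l₁ + Q →
      ⌊x / l₂⌋₊ ≤ N → ‖∑ m ∈ Ioc 0 N, dyadicExp G x (l₂ * m) * conj (dyadicExp G x (l₁ * m))‖ ≤
        P / √(j * Q : ℕ)) :
    ‖∑ l ∈ Ioc 0 ⌊x⌋₊ with l / Q = j, ∑ m ∈ Ioc 0 ⌊x⌋₊, a l * b m * dyadicExp G x (l * m)‖ ≤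
      A * B * √(x ^ 2 / Q + x * P * √T) * (j : ℝ)⁻¹ := by
  have : (0 : ℝ) < Q := by exact_mod_cast hQ
  have : (0 : ℝ) < j := by exact_mod_cast hj
  have ht₀ : (0 : ℝ) < (j * Q : ℕ) := by exact_mod_cast Nat.mul_pos hj hQ
  refine le_of_sq_le_sq ?_ (by positivity)
  calc _ ≤ A ^ 2 * B ^ 2 * (x / (j * Q) * (Q * (x / (j * Q)) + Q ^ 2 * (P / √(j * Q : ℕ)))) :=
        norm_sum_dyadicExp_block_sq_le hx (by positivity) hQ hj hA hB hcorr
    _ = A ^ 2 * B ^ 2 * (x ^ 2 / Q + x * P * √(j * Q : ℕ)) * (j : ℝ)⁻¹ ^ 2 := by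
        have hsqrt : P / √(j * Q : ℕ) = P * √(j * Q : ℕ) / (j * Q : ℕ) := by
          rw [div_eq_div_iff (Real.sqrt_pos.2 ht₀).ne' ht₀.ne', mul_assoc,
            Real.mul_self_sqrt ht₀.le]
        rw [hsqrt]
        push_cast
        field_simp
    _ ≤ A ^ 2 * B ^ 2 * (x ^ 2 / Q + x * P * √T) * (j : ℝ)⁻¹ ^ 2 := by gcongr
    _ = _ := by
        rw [mul_pow, mul_pow, mul_pow, Real.sq_sqrt (by positivity)]

theorem sum_range_floor_inv_le {x : ℝ} (hx : 1 ≤ x) :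
    ∑ j ∈ range (⌊x⌋₊ + 1), (j : ℝ)⁻¹ ≤ 1 + Real.log x := by
  have hharmonic := harmonic_floor_le_one_add_log x hx
  rw [sum_range_succ', Nat.cast_zero, inv_zero, add_zero]
  simpa [harmonic] using hharmonic

theorem typeIIBound_dyadicExp (hx : 1 ≤ x) (hP : 0 ≤ P) (hQ : 1 ≤ Q)
    (hcorr : ∀ {t l₁ l₂ N : ℕ}, 1 ≤ t → t ≤ l₁ → l₁ < l₂ → l₂ ≤ 2 * t → l₂ ≤ l₁ + Q →
      ⌊x / l₂⌋₊ ≤ N →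
      ‖∑ m ∈ Ioc 0 N, dyadicExp G x (l₂ * m) * conj (dyadicExp G x (l₁ * m))‖ ≤ P / √t) :
    TypeIIBound (dyadicExp G x) ⌊x⌋₊ Q T ((1 + Real.log x) * √(x ^ 2 / Q + x * P * √T)) := by
  intro a b A B hA₀ hB₀ hA hB haQ haT
  have hx₀ : 0 ≤ x := by linarith
  set Z := A * B * √(x ^ 2 / Q + x * P * √T) with hZ
  have hmaps : ∀ l ∈ Ioc 0 ⌊x⌋₊, l / Q ∈ range (⌊x⌋₊ + 1) := fun l hl =>
    mem_range.2 (Nat.lt_succ_iff.2 ((Nat.div_le_self _ _).trans (mem_Ioc.1 hl).2))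
  have hblock : ∀ j ∈ range (⌊x⌋₊ + 1), ‖∑ l ∈ Ioc 0 ⌊x⌋₊ with l / Q = j,
      ∑ m ∈ Ioc 0 ⌊x⌋₊, a l * b m * dyadicExp G x (l * m)‖ ≤ Z * (j : ℝ)⁻¹ := fun j _ => by
    by_cases hzero : ∀ l ∈ (Ioc 0 ⌊x⌋₊).filter (· / Q = j), a l = 0
    · rw [sum_eq_zero fun l hl => by simp only [hzero l hl, zero_mul, sum_const_zero], norm_zero]
      positivity
    push Not at hzero
    obtain ⟨l, hl, hal⟩ := hzero
    obtain ⟨-, rfl⟩ := mem_filter.1 hl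
    have hj : 1 ≤ l / Q := Nat.div_pos (not_lt.1 fun h => hal (haQ l h)) hQ
    have hlT : (l : ℝ) ≤ T := not_lt.1 fun h => hal (haT l h)
    have hT : ((l / Q * Q : ℕ) : ℝ) ≤ T :=
      (Nat.cast_le.2 (Nat.div_mul_le_self l Q)).trans hlT
    exact norm_sum_dyadicExp_block_le hx₀ hP hQ hj hT hA₀ hB₀ hA hB
      (hcorr (Nat.mul_pos hj hQ))
  calc _ = ‖∑ j ∈ range (⌊x⌋₊ + 1), ∑ l ∈ Ioc 0 ⌊x⌋₊ with l / Q = j,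
          ∑ m ∈ Ioc 0 ⌊x⌋₊, a l * b m * dyadicExp G x (l * m)‖ := by
        rw [sum_fiberwise_of_maps_to hmaps]
    _ ≤ Z * ∑ j ∈ range (⌊x⌋₊ + 1), (j : ℝ)⁻¹ := by
        rw [mul_sum]
        exact norm_sum_le_of_le _ hblock
    _ ≤ Z * (1 + Real.log x) := by
        gcongr
        exact sum_range_floor_inv_le hx
    _ = _ := by rw [hZ]; ring

end Blocks

theorem typeIIBound_dyadicExp_psPhase {γ β κ θ x : ℝ} {Q : ℕ} (hγ₀ : 3 / 4 ≤ γ) (hγ₁ : γ < 1)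
    (hκ : 0 < κ) (hx : 1 ≤ x) (hβ : |β| ≤ x / 8) (hQ : 1 ≤ Q) (T : ℝ) :
    TypeIIBound (dyadicExp (psPhase κ β γ θ) x) ⌊x⌋₊ Q T
      ((1 + Real.log x) * √(x ^ 2 / Q + x * (2304 / √(γ * (1 - γ)) *
        (√κ * √Q * x ^ (γ / 2) + x ^ (1 - γ / 2) / √κ)) * √T)) :=
  typeIIBound_dyadicExp hx (by positivity) hQ fun ht htl hl hlt hlQ hN =>
    norm_sum_dyadicExp_mul_conj_le hγ₀ hγ₁ hκ (by linarith) hβ ht htl hl hlt hlQ hN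

end TypeII

section VonMangoldtSum

open Finset ArithmeticFunction

theorem one_add_log_le_mul_rpow {x ε : ℝ} (hx : 1 ≤ x) (hε : 0 < ε) :
    1 + Real.log x ≤ (1 + 1 / ε) * x ^ ε := by
  have hlog := Real.log_le_rpow_div (by linarith : 0 ≤ x) hε
  have hone := Real.one_le_rpow hx hε.le
  calc 1 + Real.log x ≤ x ^ ε + x ^ ε / ε := by linarith
    _ = _ := by ring

theorem sqrt_mul_mul_add_div_sqrt_mul_le {h k a b : ℝ} (hh : 1 ≤ h) (hk : 0 < k) (ha : 0 ≤ a)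
    (hb : 0 ≤ b) : √(h * k) * a + b / √(h * k) ≤ (√k + 1 / √k) * (√h * a + b) := by
  have hsk := Real.sqrt_pos.2 hk
  have hdiv : b / (√h * √k) ≤ b / √k := by
    gcongr
    exact le_mul_of_one_le_left hsk.le (Real.one_le_sqrt.2 hh)
  rw [Real.sqrt_mul (by linarith)]
  calc _ ≤ √h * √k * a + b / √k + (√k * b + 1 / √k * (√h * a)) := by
        linarith [show 0 ≤ √k * b + 1 / √k * (√h * a) by positivity]
    _ = _ := by ring

theorem sqrt_mul_rpow_add_rpow_le {x h δ e s t : ℝ} (hx : 1 ≤ x)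
    (hs : s + δ / 2 ≤ e) (ht : t ≤ e) :
    √h * x ^ s + x ^ t ≤ x ^ e * (1 + √(h / x ^ δ)) := by
  have hx₀ : 0 < x := by linarith
  have hsqrt : √h = √(h / x ^ δ) * x ^ (δ / 2) := by
    rw [Real.sqrt_div' _ (by positivity), Real.sqrt_eq_rpow (x ^ δ), ← Real.rpow_mul hx₀.le,
      mul_one_div, div_mul_cancel₀ _ (by positivity)]
  calc √h * x ^ s + x ^ t = √(h / x ^ δ) * x ^ (s + δ / 2) + x ^ t := by
        rw [hsqrt, mul_assoc, ← Real.rpow_add hx₀, add_comm (δ / 2) s]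
    _ ≤ √(h / x ^ δ) * x ^ e + x ^ e := by gcongr
    _ = _ := by ring

section Sizes

variable {γ δ x h k c : ℝ}

theorem sq_mul_typeI_size_le (hγ₀ : 11 / 12 ≤ γ) (hγ₁ : γ ≤ 1) (hδ : δ ≤ (3 - 2 * γ) / 14)
    (hx : 1 ≤ x) (hh : 1 ≤ h) (hk : 0 < k) (hc : 0 ≤ c) :
    (x ^ (1 / 6 : ℝ)) ^ 2 * (c * (√(h * k) * x ^ (γ / 2) + x ^ (1 - γ / 2) / √(h * k))) ≤
      c * (√k + 1 / √k) * (x ^ (1 - δ) * (1 + √(h / x ^ δ))) := by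
  have hx₀ : 0 < x := by linarith
  have hU : (x ^ (1 / 6 : ℝ)) ^ 2 = x ^ (1 / 3 : ℝ) := by
    rw [← Real.rpow_natCast, ← Real.rpow_mul hx₀.le]
    norm_num
  calc _ ≤ x ^ (1 / 3 : ℝ) * (c * ((√k + 1 / √k) * (√h * x ^ (γ / 2) + x ^ (1 - γ / 2)))) := by
        rw [hU]
        gcongr
        exact sqrt_mul_mul_add_div_sqrt_mul_le hh hk (by positivity) (by positivity)
    _ = c * (√k + 1 / √k) * (√h * x ^ (1 / 3 + γ / 2) + x ^ (1 / 3 + (1 - γ / 2))) := by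
        rw [Real.rpow_add hx₀, Real.rpow_add hx₀]
        ring
    _ ≤ _ := by
        gcongr
        exact sqrt_mul_rpow_add_rpow_le hx (by linarith) (by linarith)

theorem sq_div_floor_rpow_le (hx : 1 ≤ x) (hδ : 0 ≤ δ) :
    x ^ 2 / ⌊x ^ δ⌋₊ ≤ 2 * x ^ (2 - δ) := by
  have hx₀ : 0 < x := by linarith
  have hone : 1 ≤ x ^ δ := Real.one_le_rpow hx hδ
  have hfloor : x ^ δ / 2 ≤ ⌊x ^ δ⌋₊ := by
    have hlt := Nat.lt_floor_add_one (x ^ δ)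
    have hone' : (1 : ℝ) ≤ ⌊x ^ δ⌋₊ := by exact_mod_cast Nat.floor_pos.2 hone
    linarith
  calc x ^ 2 / ⌊x ^ δ⌋₊ ≤ x ^ 2 / (x ^ δ / 2) := by gcongr
    _ = _ := by rw [Real.rpow_sub hx₀, Real.rpow_two]; field_simp

-- `δ = (3 - 2 * γ) / 14` is where `x ^ (1 + 1 / 4 + γ / 2 + 3 * δ / 2)` balances `x ^ (2 - 2 * δ)`.
theorem mul_correlation_size_mul_le {Q : ℝ} (hγ₀ : 11 / 12 ≤ γ) (hδ : δ ≤ (3 - 2 * γ) / 14)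
    (hx : 1 ≤ x) (hh : 1 ≤ h) (hk : 0 < k) (hc : 0 ≤ c) (hQ : √Q ≤ x ^ δ) :
    x * (c * (√(h * k) * √Q * x ^ (γ / 2) + x ^ (1 - γ / 2) / √(h * k))) * √√x ≤
      c * (√k + 1 / √k) * (x ^ (2 - 2 * δ) * (1 + √(h / x ^ δ))) := by
  have hx₀ : 0 < x := by linarith
  have hx₄ : √√x = x ^ (1 / 4 : ℝ) := by
    rw [Real.sqrt_eq_rpow, Real.sqrt_eq_rpow, ← Real.rpow_mul hx₀.le]
    norm_num
  calc _ ≤ x * (c * ((√k + 1 / √k) * (√h * (x ^ δ * x ^ (γ / 2)) + x ^ (1 - γ / 2)))) *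
          x ^ (1 / 4 : ℝ) := by
        rw [hx₄]
        gcongr
        refine le_trans ?_ (sqrt_mul_mul_add_div_sqrt_mul_le hh hk (by positivity)
          (by positivity))
        rw [mul_assoc]
        gcongr
    _ = c * (√k + 1 / √k) * (√h * x ^ (1 + δ + γ / 2 + 1 / 4) +
          x ^ (1 + (1 - γ / 2) + 1 / 4)) := by
        rw [Real.rpow_add hx₀, Real.rpow_add hx₀, Real.rpow_add hx₀, Real.rpow_add hx₀ _ (1 / 4),
          Real.rpow_add hx₀, Real.rpow_one]
        ring
    _ ≤ _ := by
        gcongr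
        exact sqrt_mul_rpow_add_rpow_le hx (by linarith) (by linarith)

theorem typeII_size_le (hγ₀ : 11 / 12 ≤ γ) (hδ₀ : 0 ≤ δ) (hδ : δ ≤ (3 - 2 * γ) / 14)
    (hx : 1 ≤ x) (hh : 1 ≤ h) (hk : 0 < k) (hc : 0 ≤ c) :
    x ^ 2 / ⌊x ^ (2 * δ)⌋₊ + x * (c * (√(h * k) * √⌊x ^ (2 * δ)⌋₊ * x ^ (γ / 2) +
        x ^ (1 - γ / 2) / √(h * k))) * √√x ≤
      (2 + c * (√k + 1 / √k)) * (x ^ (1 - δ) * (1 + √(h / x ^ δ))) ^ 2 := by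
  have hx₀ : 0 < x := by linarith
  set Q := ⌊x ^ (2 * δ)⌋₊
  set r := √(h / x ^ δ)
  have hr : 0 ≤ r := Real.sqrt_nonneg _
  have hsQ : √(Q : ℝ) ≤ x ^ δ := by
    rw [Real.sqrt_le_left (by positivity), ← Real.rpow_natCast, ← Real.rpow_mul hx₀.le, mul_comm]
    exact Nat.floor_le (by positivity)
  have hsq : (x ^ (1 - δ)) ^ 2 = x ^ (2 - 2 * δ) := by
    rw [← Real.rpow_natCast, ← Real.rpow_mul hx₀.le]
    push_cast
    ring_nf
  calc _ ≤ 2 * x ^ (2 - 2 * δ) + c * (√k + 1 / √k) * (x ^ (2 - 2 * δ) * (1 + r)) :=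
        add_le_add (sq_div_floor_rpow_le hx (by linarith))
          (mul_correlation_size_mul_le hγ₀ hδ hx hh hk hc hsQ)
    _ ≤ 2 * (x ^ (2 - 2 * δ) * (1 + r)) + c * (√k + 1 / √k) * (x ^ (2 - 2 * δ) * (1 + r)) := by
        gcongr
        exact le_mul_of_one_le_right (by positivity) (by linarith)
    _ = (2 + c * (√k + 1 / √k)) * (x ^ (2 - 2 * δ) * (1 + r)) := by ring
    _ ≤ (2 + c * (√k + 1 / √k)) * (x ^ (2 - 2 * δ) * (1 + r) ^ 2) := by
        gcongr
        exact le_self_pow₀ (by linarith) two_ne_zero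
    _ = _ := by rw [mul_pow, hsq]

end Sizes

theorem norm_sum_vonMangoldt_mul_dyadicExp_le {γ β κ θ x B U : ℝ} {Q : ℕ} (hγ₀ : 3 / 4 ≤ γ)
    (hγ₁ : γ < 1) (hκ : 0 < κ) (hx : 1 ≤ x) (hβ : |β| ≤ x / 8) (hQ : 1 ≤ Q) (hQU : (Q : ℝ) ≤ U)
    (hB : 0 ≤ B) (hd : ∀ m ∈ Ioc 0 ⌊x⌋₊, (m.divisors.card : ℝ) ≤ B) :
    ‖∑ n ∈ Ioc 0 ⌊x⌋₊, (Λ n : ℂ) * dyadicExp (psPhase κ β γ θ) x n‖ ≤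
      (1 + Real.log x) * (U + 2 * (U ^ 2 *
        (256 / √(γ * (1 - γ)) * (√κ * x ^ (γ / 2) + x ^ (1 - γ / 2) / √κ))) +
        2 * (B * ((1 + Real.log x) * √(x ^ 2 / Q + x * (2304 / √(γ * (1 - γ)) *
          (√κ * √Q * x ^ (γ / 2) + x ^ (1 - γ / 2) / √κ)) * √√x)))) := by
  have hx₀ : 0 < x := by linarith
  have hlog : 0 ≤ Real.log x := Real.log_nonneg hx
  have hU : 1 ≤ U := (by exact_mod_cast hQ : (1 : ℝ) ≤ Q).trans hQU
  have hfloor : (⌊x⌋₊ : ℝ) ≤ x := Nat.floor_le hx₀.le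
  have hfloor₁ : 1 ≤ ⌊x⌋₊ := Nat.floor_pos.2 hx
  have hlog_floor : Real.log ⌊x⌋₊ ≤ 1 + Real.log x := by
    have := Real.log_le_log (by exact_mod_cast hfloor₁) hfloor
    linarith
  refine (norm_sum_vonMangoldt_mul_le (norm_dyadicExp_le _ x)
    (fun n hn => dyadicExp_eq_zero _ ((Nat.floor_lt hx₀.le).1 hn)) hfloor₁
    (typeIBound_dyadicExp_psPhase (by linarith) hγ₁ hκ hx₀ hβ)
    (typeIIBound_dyadicExp_psPhase hγ₀ hγ₁ hκ hx hβ hQ (√x)) (Real.sqrt_nonneg x)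
    (by rwa [Real.sq_sqrt hx₀.le]) hQU hB hd).trans ?_
  gcongr ?_ * (U + ?_ + _)
  rw [add_mul, two_mul]
  gcongr
  exact le_self_pow₀ hU two_ne_zero

theorem exists_norm_sum_vonMangoldt_mul_dyadicExp_le {γ δ β k ε : ℝ} (hγ₀ : 11 / 12 ≤ γ)
    (hγ₁ : γ < 1) (hδ₀ : 0 ≤ δ) (hδ : δ ≤ (3 - 2 * γ) / 14) (hk : 0 < k) (hε : 0 < ε) :
    ∃ C : ℝ, 0 < C ∧ ∀ (x θ : ℝ) (h : ℕ), 1 ≤ x → |β| ≤ x / 8 → 1 ≤ h →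
      ‖∑ n ∈ Ioc 0 ⌊x⌋₊, (Λ n : ℂ) * dyadicExp (psPhase (h * k) β γ θ) x n‖ ≤
        C * x ^ (1 - δ + ε) * (1 + √(h / x ^ δ)) := by
  have hε₃ : 0 < ε / 3 := by linarith
  obtain ⟨Cd, hCd₁, hCd⟩ := exists_card_divisors_le_rpow_of_mem_Ioc hε₃
  set c₁ := 256 / √(γ * (1 - γ)) * (√k + 1 / √k)
  set c₂ := 2 + 2304 / √(γ * (1 - γ)) * (√k + 1 / √k)
  set L := 1 + 1 / (ε / 3)
  have : 1 ≤ L := le_add_of_nonneg_right (by positivity)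
  refine ⟨L * (1 + 2 * c₁ + 2 * (Cd * (L * √c₂))), by positivity, fun x θ h hx hβ hh => ?_⟩
  have hx₀ : 0 < x := by linarith
  have hh₁ : (1 : ℝ) ≤ h := by exact_mod_cast hh
  set E := x ^ (ε / 3)
  have hE : 1 ≤ E := Real.one_le_rpow hx hε₃.le
  set Y := x ^ (1 - δ) * (1 + √(h / x ^ δ)) with hY
  have hlog : 1 + Real.log x ≤ L * E := one_add_log_le_mul_rpow hx hε₃
  have hlog₀ : 0 ≤ 1 + Real.log x := by linarith [Real.log_nonneg hx]
  have hQU : (⌊x ^ (2 * δ)⌋₊ : ℝ) ≤ x ^ (1 / 6 : ℝ) := (Nat.floor_le (by positivity)).trans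
    (Real.rpow_le_rpow_of_exponent_le hx (by linarith))
  have hUY : x ^ (1 / 6 : ℝ) ≤ Y :=
    (Real.rpow_le_rpow_of_exponent_le hx (by linarith)).trans
      (le_mul_of_one_le_right (by positivity) (le_add_of_nonneg_right (Real.sqrt_nonneg _)))
  have htypeI := sq_mul_typeI_size_le (c := 256 / √(γ * (1 - γ))) hγ₀ hγ₁.le hδ hx hh₁ hk
    (by positivity)
  have hsqrt : √(c₂ * Y ^ 2) = √c₂ * Y := by
    rw [Real.sqrt_mul (by positivity), Real.sqrt_sq (by positivity)]
  have htypeII := (Real.sqrt_le_sqrt (typeII_size_le (c := 2304 / √(γ * (1 - γ))) hγ₀ hδ₀ hδ hx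
    hh₁ hk (by positivity))).trans_eq hsqrt
  calc _ ≤ _ := norm_sum_vonMangoldt_mul_dyadicExp_le (by linarith) hγ₁ (by positivity) hx hβ
        (Nat.floor_pos.2 (Real.one_le_rpow hx (by linarith))) hQU (by positivity)
        (hCd x hx₀.le)
    _ ≤ L * E * (Y + 2 * (c₁ * Y) + 2 * (Cd * E * (L * E * (√c₂ * Y)))) := by gcongr
    _ ≤ L * E * (Y * E ^ 2 + 2 * (c₁ * (Y * E ^ 2)) + 2 * (Cd * E * (L * E * (√c₂ * Y)))) := by
        have hYE : Y ≤ Y * E ^ 2 := le_mul_of_one_le_right (by positivity) (one_le_pow₀ hE)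
        gcongr
    _ = L * (1 + 2 * c₁ + 2 * (Cd * (L * √c₂))) * (Y * E ^ 3) := by ring
    _ = _ := by
        have hE₃ : x ^ (1 - δ + ε) = x ^ (1 - δ) * E ^ 3 := by
          rw [Real.rpow_add hx₀, ← Real.rpow_natCast E, ← Real.rpow_mul hx₀.le]
          push_cast
          ring_nf
        rw [hE₃, hY]
        ring

end VonMangoldtSum

section ResidueClass

open Finset

variable {q : ℕ} [NeZero q]

theorem stdAddChar_mul_natCast (j : ZMod q) (n : ℕ) :
    ZMod.stdAddChar (j * (n : ZMod q)) = unitExp (j.val / q * n) := by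
  have hcast : j * (n : ZMod q) = ((j.val * n : ℤ) : ZMod q) := by simp
  rw [hcast, ZMod.stdAddChar_coe, unitExp_apply]
  push_cast
  ring_nf

theorem sum_filter_intModEq_eq (s : Finset ℕ) (z : ℕ → ℂ) (a : ℤ) :
    ∑ n ∈ s with (n : ℕ) ≡ a [ZMOD q], z n = (q : ℂ)⁻¹ * ∑ j : ZMod q,
      ZMod.stdAddChar (-(j * (a : ZMod q))) * ∑ n ∈ s, z n * unitExp (j.val / q * n) := by
  have hq : (q : ℂ) ≠ 0 := NeZero.ne _
  simp_rw [mul_sum]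
  rw [sum_comm, sum_filter]
  refine sum_congr rfl fun n _ => ?_
  have horth := AddChar.sum_mulShift ((n : ZMod q) - (a : ZMod q)) (ZMod.isPrimitive_stdAddChar q)
  have hiff : (n : ZMod q) - (a : ZMod q) = 0 ↔ (n : ℤ) ≡ a [ZMOD q] := by
    rw [← ZMod.intCast_eq_intCast_iff, sub_eq_zero, Int.cast_natCast]
  simp only [hiff, ZMod.card] at horth
  calc (if (n : ℤ) ≡ a [ZMOD q] then z n else 0)
      = (q : ℂ)⁻¹ * z n * ∑ j : ZMod q, ZMod.stdAddChar (j * ((n : ZMod q) - (a : ZMod q))) := by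
        rw [horth]
        split_ifs <;> field_simp
        simp
    _ = _ := by
        rw [mul_sum]
        refine sum_congr rfl fun j _ => ?_
        rw [← stdAddChar_mul_natCast, mul_sub, sub_eq_neg_add, AddChar.map_add_eq_mul]
        ring

theorem norm_sum_filter_intModEq_le (s : Finset ℕ) (z : ℕ → ℂ) (a : ℤ) {R : ℝ}
    (h : ∀ θ : ℝ, ‖∑ n ∈ s, z n * unitExp (θ * n)‖ ≤ R) :
    ‖∑ n ∈ s with (n : ℕ) ≡ a [ZMOD q], z n‖ ≤ R := by
  have hq : (q : ℝ) ≠ 0 := NeZero.ne _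
  have hsum : ‖∑ j : ZMod q, ZMod.stdAddChar (-(j * (a : ZMod q))) *
      ∑ n ∈ s, z n * unitExp (j.val / q * n)‖ ≤ q * R := by
    refine (norm_sum_le_of_le (n := fun _ => R) _ fun j _ => ?_).trans_eq (by simp)
    rw [norm_mul, AddChar.norm_apply, one_mul]
    exact h _
  rw [sum_filter_intModEq_eq, norm_mul, norm_inv, Complex.norm_natCast]
  calc _ ≤ (q : ℝ)⁻¹ * (q * R) := by gcongr
    _ = R := inv_mul_cancel_left₀ hq R

end ResidueClass

section PrimeSum

open Finset ArithmeticFunction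

theorem psi_sub_theta_le_mul_rpow {x : ℝ} (hx : 1 ≤ x) :
    Chebyshev.psi x - Chebyshev.theta x ≤ 8 * x ^ (3 / 4 : ℝ) := by
  have hx₀ : 0 < x := by linarith
  calc Chebyshev.psi x - Chebyshev.theta x ≤ 2 * √x * Real.log x := Chebyshev.psi_sub_theta_le hx
    _ ≤ 2 * x ^ (1 / 2 : ℝ) * (x ^ (1 / 4 : ℝ) / (1 / 4)) := by
        rw [Real.sqrt_eq_rpow]
        gcongr
        exact Real.log_le_rpow_div hx₀.le (by norm_num)
    _ = 8 * (x ^ (1 / 2 : ℝ) * x ^ (1 / 4 : ℝ)) := by ring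
    _ = _ := by
        rw [← Real.rpow_add hx₀]
        norm_num

theorem norm_sum_log_prime_mul_le {F : ℕ → ℂ} (hF : ∀ n, ‖F n‖ ≤ 1) {x : ℝ} (hx : 1 ≤ x) :
    ‖∑ p ∈ Ioc 0 ⌊x⌋₊ with p.Prime, (Real.log p : ℂ) * F p‖ ≤
      ‖∑ n ∈ Ioc 0 ⌊x⌋₊, (Λ n : ℂ) * F n‖ + 8 * x ^ (3 / 4 : ℝ) := by
  have hprime : ∑ p ∈ Ioc 0 ⌊x⌋₊ with p.Prime, (Real.log p : ℂ) * F p =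
      ∑ p ∈ Ioc 0 ⌊x⌋₊ with p.Prime, (Λ p : ℂ) * F p :=
    sum_congr rfl fun p hp => by rw [vonMangoldt_apply_prime (mem_filter.1 hp).2]
  have hnonprime : ‖∑ n ∈ Ioc 0 ⌊x⌋₊ with ¬ n.Prime, (Λ n : ℂ) * F n‖ ≤ 8 * x ^ (3 / 4 : ℝ) := by
    refine le_trans ?_ (psi_sub_theta_le_mul_rpow hx)
    rw [Chebyshev.psi_sub_theta_eq_sum_not_prime]
    refine norm_sum_le_of_le _ fun n _ => ?_
    rw [norm_mul, Complex.norm_of_nonneg vonMangoldt_nonneg]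
    exact mul_le_of_le_one_right vonMangoldt_nonneg (hF n)
  rw [hprime, eq_sub_of_add_eq
    (sum_filter_add_sum_filter_not (Ioc 0 ⌊x⌋₊) Nat.Prime fun n => (Λ n : ℂ) * F n)]
  exact (norm_sub_le _ _).trans (by gcongr)

theorem exists_norm_sum_log_prime_mul_dyadicExp_le {γ δ β k ε : ℝ} (hγ₀ : 11 / 12 ≤ γ)
    (hγ₁ : γ < 1) (hδ₀ : 0 ≤ δ) (hδ : δ ≤ (3 - 2 * γ) / 14) (hk : 0 < k) (hε : 0 < ε) :
    ∃ C : ℝ, 0 < C ∧ ∀ (x θ : ℝ) (h : ℕ), 1 ≤ x → |β| ≤ x / 8 → 1 ≤ h →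
      ‖∑ p ∈ Ioc 0 ⌊x⌋₊ with p.Prime, (Real.log p : ℂ) *
          dyadicExp (psPhase (h * k) β γ θ) x p‖ ≤
        C * x ^ (1 - δ + ε) * (1 + √(h / x ^ δ)) := by
  obtain ⟨C, hC, hCb⟩ :=
    exists_norm_sum_vonMangoldt_mul_dyadicExp_le (β := β) hγ₀ hγ₁ hδ₀ hδ hk hε
  refine ⟨C + 8, by positivity, fun x θ h hx hβ hh => ?_⟩
  calc _ ≤ _ := norm_sum_log_prime_mul_le (norm_dyadicExp_le _ x) hx
    _ ≤ C * x ^ (1 - δ + ε) * (1 + √(h / x ^ δ)) + 8 * x ^ (1 - δ + ε) := by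
        gcongr
        · exact hCb x θ h hx hβ hh
        · linarith
    _ ≤ C * x ^ (1 - δ + ε) * (1 + √(h / x ^ δ)) +
          8 * (x ^ (1 - δ + ε) * (1 + √(h / x ^ δ))) := by
        gcongr
        exact le_mul_of_one_le_right (by positivity) (le_add_of_nonneg_right (Real.sqrt_nonneg _))
    _ = _ := by ring

end PrimeSum

section SawtoothSum

open Finset

variable {α β γ δ ε x : ℝ} {q : ℕ} {a : ℤ} {p : ℕ}

/-- The primes over which `thetaAP x q a` is summed. -/
noncomputable def primesAP (x : ℝ) (q : ℕ) (a : ℤ) : Finset ℕ :=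
  {p ∈ Icc 1 ⌊x⌋₊ | p.Prime ∧ (p : ℤ) ≡ a [ZMOD (q : ℤ)]}

/-- The inverse function of `t ↦ α * t ^ γ⁻¹ + β`. A prime `p` is of the form `⌊α * n ^ γ⁻¹ + β⌋`
when `n` lies in the interval from `psInverse α β γ p` to `psInverse α (β - 1) γ p`. -/
noncomputable def psInverse (α β γ t : ℝ) : ℝ := ((t - β) / α) ^ γ

/-- The sum over the primes `p ≤ x` in a residue class whose differences for `β - 1` and `β` make up
the fluctuating part of `thetaPS`. -/
noncomputable def sawtoothSum (α β γ x : ℝ) (q : ℕ) (a : ℤ) : ℝ :=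
  ∑ p ∈ primesAP x q a, Real.log p * sawtooth (-psInverse α β γ p)

theorem one_le_of_mem_primesAP (hp : p ∈ primesAP x q a) : 1 ≤ p :=
  (mem_Icc.1 (mem_filter.1 hp).1).1

theorem le_of_mem_primesAP (hp : p ∈ primesAP x q a) : (p : ℝ) ≤ x :=
  (Nat.le_floor_iff' (by have := one_le_of_mem_primesAP hp; omega)).1
    (mem_Icc.1 (mem_filter.1 hp).1).2

theorem log_nonneg_of_mem_primesAP (hp : p ∈ primesAP x q a) : 0 ≤ Real.log p :=
  Real.log_nonneg (by exact_mod_cast one_le_of_mem_primesAP hp)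

theorem log_le_of_mem_primesAP (hp : p ∈ primesAP x q a) : Real.log p ≤ Real.log x :=
  Real.log_le_log (by exact_mod_cast one_le_of_mem_primesAP hp) (le_of_mem_primesAP hp)

theorem primesAP_half_subset (hx : 0 ≤ x) : primesAP (x / 2) q a ⊆ primesAP x q a :=
  filter_subset_filter _ (Icc_subset_Icc_right (Nat.floor_mono (half_le_self hx)))

theorem primesAP_sdiff_primesAP_half :
    primesAP x q a \ primesAP (x / 2) q a =
      {p ∈ {p ∈ Ioc ⌊x / 2⌋₊ ⌊x⌋₊ | p.Prime} | (p : ℕ) ≡ a [ZMOD (q : ℤ)]} := by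
  ext p
  simp only [primesAP, mem_sdiff, mem_filter, mem_Icc, mem_Ioc]
  constructor
  · rintro ⟨⟨⟨hp, hpx⟩, hprime, hmod⟩, hnot⟩
    exact ⟨⟨⟨not_le.1 fun h => hnot ⟨⟨hp, h⟩, hprime, hmod⟩, hpx⟩, hprime⟩, hmod⟩
  · rintro ⟨⟨⟨hp, hpx⟩, hprime⟩, hmod⟩
    exact ⟨⟨⟨by omega, hpx⟩, hprime, hmod⟩, fun h => by omega⟩

theorem sum_log_primesAP_le (hx : 1 ≤ x) : ∑ p ∈ primesAP x q a, Real.log p ≤ x * Real.log x := by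
  have hlog := Real.log_nonneg hx
  have hcard : ((primesAP x q a).card : ℝ) ≤ x := by
    have hle := card_filter_le (Icc 1 ⌊x⌋₊) fun p : ℕ => p.Prime ∧ (p : ℤ) ≡ a [ZMOD (q : ℤ)]
    rw [Nat.card_Icc, Nat.add_sub_cancel] at hle
    exact (Nat.cast_le.2 hle).trans (Nat.floor_le (by linarith))
  calc _ ≤ ∑ _p ∈ primesAP x q a, Real.log x := sum_le_sum fun p => log_le_of_mem_primesAP
    _ = (primesAP x q a).card * Real.log x := by rw [sum_const, nsmul_eq_mul]
    _ ≤ _ := by gcongr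

theorem unitExp_neg_psInverse_mul {h θ t : ℝ} (hα : 0 < α) (ht : β ≤ t) :
    unitExp (h * -psInverse α β γ t) * unitExp (θ * t) =
      unitExp (psPhase (h * α ^ (-γ)) β γ θ t) := by
  rw [← AddChar.map_add_eq_mul, psInverse, psPhase, Real.div_rpow (by linarith) hα.le,
    Real.rpow_neg hα.le]
  ring_nf

theorem sum_dyadic_log_mul_unitExp_eq {h θ : ℝ} (hα : 0 < α) (hβ : |β| ≤ x / 8) :
    ∑ p ∈ Ioc ⌊x / 2⌋₊ ⌊x⌋₊ with p.Prime,
        Real.log p * unitExp (h * -psInverse α β γ p) * unitExp (θ * p) =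
      ∑ p ∈ Ioc 0 ⌊x⌋₊ with p.Prime,
        (Real.log p : ℂ) * dyadicExp (psPhase (h * α ^ (-γ)) β γ θ) x p := by
  have hx : 0 ≤ x := by linarith [abs_nonneg β]
  rw [← sum_subset (filter_subset_filter _ (Ioc_subset_Ioc_left (Nat.zero_le ⌊x / 2⌋₊)))]
  · refine sum_congr rfl fun p hp => ?_
    rw [mem_filter, mem_Ioc, Nat.floor_lt (by linarith), Nat.le_floor_iff hx] at hp
    rw [dyadicExp, if_pos hp.1, mul_assoc,
      unitExp_neg_psInverse_mul hα (by linarith [le_abs_self β, hp.1.1])]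
  · intro p hp hnot
    rw [mem_filter, mem_Ioc] at hp hnot
    have hhalf : ¬ x / 2 < p := fun h =>
      hnot ⟨⟨(Nat.floor_lt (by linarith)).2 h, hp.1.2⟩, hp.2⟩
    rw [dyadicExp, if_neg fun h => hhalf h.1, mul_zero]

theorem exists_norm_sum_dyadic_primesAP_le (hα : 0 < α) (hγ₀ : 11 / 12 ≤ γ) (hγ₁ : γ < 1)
    (hδ₀ : 0 ≤ δ) (hδ : δ ≤ (3 - 2 * γ) / 14) (hε : 0 < ε) :
    ∃ C : ℝ, 0 < C ∧ ∀ (q : ℕ) (a : ℤ) (x : ℝ) (h : ℕ), 1 ≤ q → 1 ≤ x → |β| ≤ x / 8 → 1 ≤ h →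
      ‖∑ p ∈ primesAP x q a \ primesAP (x / 2) q a,
          (Real.log p : ℂ) * unitExp (h * -psInverse α β γ p)‖ ≤
        C * x ^ (1 - δ + ε) * (1 + √(h / x ^ δ)) := by
  obtain ⟨C, hC, hCb⟩ := exists_norm_sum_log_prime_mul_dyadicExp_le (β := β) hγ₀ hγ₁ hδ₀ hδ
    (Real.rpow_pos_of_pos hα (-γ)) hε
  refine ⟨C, hC, fun q a x h hq hx hβ hh => ?_⟩
  have : NeZero q := ⟨by omega⟩
  rw [primesAP_sdiff_primesAP_half]
  refine norm_sum_filter_intModEq_le _ _ a fun θ => ?_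
  rw [sum_dyadic_log_mul_unitExp_eq hα hβ]
  exact hCb x θ h hx hβ hh

theorem abs_sum_log_mul_sawtooth_le {s : Finset ℕ} (f : ℕ → ℝ) (hs : s ⊆ primesAP x q a) :
    |∑ p ∈ s, Real.log p * sawtooth (f p)| ≤ ∑ p ∈ primesAP x q a, Real.log p := by
  have hlog : ∀ p ∈ s, 0 ≤ Real.log p := fun p hp => log_nonneg_of_mem_primesAP (hs hp)
  calc _ ≤ ∑ p ∈ s, |Real.log p * sawtooth (f p)| := abs_sum_le_sum_abs _ _
    _ ≤ ∑ p ∈ s, Real.log p := sum_le_sum fun p hp => by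
        rw [abs_mul, abs_of_nonneg (hlog p hp)]
        exact mul_le_of_le_one_right (hlog p hp) (by linarith [abs_sawtooth_le (f p)])
    _ ≤ _ := sum_le_sum_of_subset_of_nonneg hs fun p hp _ => log_nonneg_of_mem_primesAP hp

theorem exists_abs_sum_dyadic_sawtooth_le_of_le (hα : 0 < α) (hγ₀ : 11 / 12 ≤ γ) (hγ₁ : γ < 1)
    (hδ₀ : 0 ≤ δ) (hδ : δ ≤ (3 - 2 * γ) / 14) (hε : 0 < ε) :
    ∃ C : ℝ, 0 < C ∧ ∀ (q : ℕ) (a : ℤ) (x : ℝ), 1 ≤ q → 1 ≤ x → |β| ≤ x / 8 →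
      |∑ p ∈ primesAP x q a \ primesAP (x / 2) q a, Real.log p * sawtooth (-psInverse α β γ p)| ≤
        C * x ^ (1 - δ + ε) := by
  set η := min (ε / 2) (1 / 2)
  have hη₀ : 0 < η := by positivity
  have hη₁ : η ≤ ε / 2 := min_le_left _ _
  obtain ⟨C, hC, hCb⟩ :=
    exists_norm_sum_dyadic_primesAP_le (β := β) hα hγ₀ hγ₁ hδ₀ hδ (half_pos hε)
  set Z := ∑' h : ℕ, 1 / (h : ℝ) ^ (1 + η)
  have : 0 ≤ Z := tsum_nonneg fun h => by positivity
  refine ⟨1 / ε + 2 * Z * C, by positivity, fun q a x hq hx hβ => ?_⟩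
  have hx₀ : 0 < x := by linarith
  set s := primesAP x q a \ primesAP (x / 2) q a
  have hlog : ∀ p ∈ s, 0 ≤ Real.log (p : ℝ) := fun p hp =>
    log_nonneg_of_mem_primesAP (mem_sdiff.1 hp).1
  have hmean : (x ^ δ)⁻¹ * ∑ p ∈ s, Real.log (p : ℝ) ≤ 1 / ε * x ^ (1 - δ + ε) :=
    calc _ ≤ (x ^ δ)⁻¹ * (x * (x ^ ε / ε)) := by
          gcongr
          calc _ ≤ ∑ p ∈ primesAP x q a, Real.log p := sum_le_sum_of_subset_of_nonneg
                sdiff_subset fun p hp _ => log_nonneg_of_mem_primesAP hp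
            _ ≤ x * Real.log x := sum_log_primesAP_le hx
            _ ≤ _ := by
                gcongr
                exact Real.log_le_rpow_div hx₀.le hε
      _ = _ := by
          rw [Real.rpow_add hx₀, Real.rpow_sub hx₀, Real.rpow_one]
          field_simp
  have hexponent : x ^ (1 - δ + ε / 2) * (x ^ δ) ^ η ≤ x ^ (1 - δ + ε) := by
    rw [← Real.rpow_mul hx₀.le, ← Real.rpow_add hx₀]
    exact Real.rpow_le_rpow_of_exponent_le hx (by nlinarith)
  calc _ ≤ (x ^ δ)⁻¹ * ∑ p ∈ s, Real.log (p : ℝ) +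
        2 * Z * (C * x ^ (1 - δ + ε / 2)) * (x ^ δ) ^ η :=
        abs_sum_mul_sawtooth_le_of_forall hη₀ (min_le_right _ _) hlog
          (Real.one_le_rpow hx hδ₀) (by positivity) fun h hh => by
            rw [← Real.sqrt_eq_rpow]
            exact hCb q a x h hq hx hβ hh
    _ = (x ^ δ)⁻¹ * ∑ p ∈ s, Real.log (p : ℝ) +
          2 * Z * C * (x ^ (1 - δ + ε / 2) * (x ^ δ) ^ η) := by ring
    _ ≤ 1 / ε * x ^ (1 - δ + ε) + 2 * Z * C * x ^ (1 - δ + ε) := by gcongr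
    _ = _ := by ring

theorem exists_abs_sum_dyadic_sawtooth_le (hα : 0 < α) (hγ₀ : 11 / 12 ≤ γ) (hγ₁ : γ < 1)
    (hδ₀ : 0 ≤ δ) (hδ : δ ≤ (3 - 2 * γ) / 14) (hε : 0 < ε) :
    ∃ C : ℝ, 0 < C ∧ ∀ (q : ℕ) (a : ℤ) (x : ℝ), 1 ≤ q → 1 ≤ x →
      |∑ p ∈ primesAP x q a \ primesAP (x / 2) q a, Real.log p * sawtooth (-psInverse α β γ p)| ≤
        C * x ^ (1 - δ + ε) := by
  obtain ⟨C, hC, hCb⟩ :=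
    exists_abs_sum_dyadic_sawtooth_le_of_le (β := β) hα hγ₀ hγ₁ hδ₀ hδ hε
  refine ⟨C + (8 * |β|) ^ 2, by positivity, fun q a x hq hx => ?_⟩
  rw [add_mul]
  rcases le_or_gt |β| (x / 8) with hβ | hβ
  · exact (hCb q a x hq hx hβ).trans (le_add_of_nonneg_right (by positivity))
  · have hxβ : x ≤ 8 * |β| := by linarith
    calc _ ≤ x * Real.log x :=
          (abs_sum_log_mul_sawtooth_le _ sdiff_subset).trans (sum_log_primesAP_le hx)
      _ ≤ x * x := by
          gcongr
          linarith [Real.log_le_sub_one_of_pos (by linarith : 0 < x)]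
      _ ≤ (8 * |β|) ^ 2 * 1 := by rw [mul_one, sq]; gcongr
      _ ≤ (8 * |β|) ^ 2 * x ^ (1 - δ + ε) := by
          gcongr
          exact Real.one_le_rpow hx (by linarith)
      _ ≤ _ := le_add_of_nonneg_left (by positivity)

theorem sawtoothSum_eq_add (hx : 0 ≤ x) :
    sawtoothSum α β γ x q a = sawtoothSum α β γ (x / 2) q a +
      ∑ p ∈ primesAP x q a \ primesAP (x / 2) q a, Real.log p * sawtooth (-psInverse α β γ p) := by
  rw [sawtoothSum, sawtoothSum, add_comm, sum_sdiff (primesAP_half_subset hx)]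

end SawtoothSum

theorem abs_le_mul_rpow_of_abs_sub_half_le {f : ℝ → ℝ} {C E : ℝ} (hC : 0 ≤ C) (hE : 0 < E)
    (hf₀ : ∀ x, 0 ≤ x → x < 1 → f x = 0)
    (hf : ∀ x, 1 ≤ x → |f x - f (x / 2)| ≤ C * x ^ E) {x : ℝ} (hx : 0 ≤ x) :
    |f x| ≤ C / (1 - (1 / 2) ^ E) * x ^ E := by
  have hρ : (1 / 2 : ℝ) ^ E < 1 := Real.rpow_lt_one (by norm_num) (by norm_num) hE
  have hgeom : 0 < 1 - (1 / 2 : ℝ) ^ E := by linarith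
  obtain ⟨n, hn⟩ := pow_unbounded_of_one_lt x (by norm_num : (1 : ℝ) < 2)
  induction n generalizing x with
  | zero =>
    rw [hf₀ x hx (by simpa using hn), abs_zero]
    positivity
  | succ n ih =>
    rcases lt_or_ge x 1 with hx₁ | hx₁
    · rw [hf₀ x hx hx₁, abs_zero]
      positivity
    · have hhalf := ih (by linarith : 0 ≤ x / 2) (by rw [pow_succ] at hn; linarith)
      calc |f x| = |f (x / 2) + (f x - f (x / 2))| := by ring_nf
        _ ≤ C / (1 - (1 / 2) ^ E) * (x / 2) ^ E + C * x ^ E :=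
            (abs_add_le _ _).trans (add_le_add hhalf (hf x hx₁))
        _ = _ := by
            rw [div_eq_mul_one_div x, mul_comm x, Real.mul_rpow (by norm_num) hx]
            field_simp
            ring

theorem exists_abs_sawtoothSum_le {α β γ δ ε : ℝ} (hα : 0 < α) (hγ₀ : 11 / 12 ≤ γ) (hγ₁ : γ < 1)
    (hδ₀ : 0 ≤ δ) (hδ : δ ≤ (3 - 2 * γ) / 14) (hε : 0 < ε) :
    ∃ C : ℝ, 0 < C ∧ ∀ (q : ℕ) (a : ℤ) (x : ℝ), 1 ≤ q → 0 ≤ x →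
      |sawtoothSum α β γ x q a| ≤ C * x ^ (1 - δ + ε) := by
  obtain ⟨C, hC, hCb⟩ := exists_abs_sum_dyadic_sawtooth_le (β := β) hα hγ₀ hγ₁ hδ₀ hδ hε
  have hE : 0 < 1 - δ + ε := by linarith
  have hgeom : 0 < 1 - (1 / 2 : ℝ) ^ (1 - δ + ε) :=
    sub_pos.2 (Real.rpow_lt_one (by norm_num) (by norm_num) hE)
  refine ⟨_, div_pos hC hgeom, fun q a x hq hx =>
    abs_le_mul_rpow_of_abs_sub_half_le (f := fun x => sawtoothSum α β γ x q a) hC.le hE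
      (fun x _ hx₁ => ?_) (fun x hx₁ => ?_) hx⟩
  · simp [sawtoothSum, primesAP, Nat.floor_eq_zero.2 hx₁]
  · rw [sawtoothSum_eq_add (by linarith : 0 ≤ x), add_sub_cancel_left]
    exact hCb q a x hq hx₁

section PiatetskiShapiro

open Filter Asymptotics

variable {α β c γ : ℝ}

theorem sub_add_sawtooth_neg_sub {u v : ℝ} (hu : 0 ≤ u) (hv : 0 ≤ v) :
    v - u + (sawtooth (-v) - sawtooth (-u)) = (⌈v⌉₊ : ℝ) - ⌈u⌉₊ := by
  rw [natCast_ceil_eq_intCast_ceil hu, natCast_ceil_eq_intCast_ceil hv, sawtooth, sawtooth,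
    ← Int.self_sub_floor, ← Int.self_sub_floor, Int.floor_neg, Int.floor_neg]
  push_cast
  ring

theorem psInverse_le_natCast_iff {t : ℝ} (hα : 0 < α) (hc : 0 < c) (ht : β ≤ t) (n : ℕ) :
    psInverse α β c⁻¹ t ≤ n ↔ t ≤ α * (n : ℝ) ^ c + β := by
  rw [psInverse, Real.rpow_inv_le_iff_of_pos (div_nonneg (by linarith) hα.le) n.cast_nonneg hc,
    div_le_iff₀' hα, sub_le_iff_le_add]

theorem natCast_mem_genPiatetskiShapiro_iff (hα : 0 < α) (hc : 0 < c) {p : ℕ} (hp : β < p) :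
    (p : ℤ) ∈ genPiatetskiShapiro α β c ↔
      ⌈psInverse α β c⁻¹ p⌉₊ < ⌈psInverse α (β - 1) c⁻¹ p⌉₊ := by
  have hfloor : ∀ n : ℕ, (p : ℤ) = ⌊α * (n : ℝ) ^ c + β⌋ ↔
      ⌈psInverse α β c⁻¹ p⌉₊ ≤ n ∧ n < ⌈psInverse α (β - 1) c⁻¹ p⌉₊ := fun n => by
    rw [Nat.ceil_le, Nat.lt_ceil, ← not_le, psInverse_le_natCast_iff hα hc hp.le,
      psInverse_le_natCast_iff hα hc (by linarith), not_le, eq_comm, Int.floor_eq_iff,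
      Int.cast_natCast, ← add_sub_assoc, sub_lt_iff_lt_add]
  have hpos : 0 < psInverse α β c⁻¹ p := Real.rpow_pos_of_pos (div_pos (by linarith) hα) _
  constructor
  · rintro ⟨n, -, hn⟩
    exact ((hfloor n).1 hn).1.trans_lt ((hfloor n).1 hn).2
  · exact fun hlt => ⟨_, Nat.ceil_pos.2 hpos, (hfloor _).2 ⟨le_rfl, hlt⟩⟩

theorem indicator_genPiatetskiShapiro_eq (hα : 0 < α) (hc : 0 < c) {p : ℕ} (hp : β < p)
    (hgap : psInverse α (β - 1) c⁻¹ p - psInverse α β c⁻¹ p ≤ 1) :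
    (genPiatetskiShapiro α β c).indicator 1 (p : ℤ) =
      psInverse α (β - 1) c⁻¹ p - psInverse α β c⁻¹ p +
        (sawtooth (-psInverse α (β - 1) c⁻¹ p) - sawtooth (-psInverse α β c⁻¹ p)) := by
  have : 0 ≤ (p : ℝ) - β := by linarith
  have hu : 0 ≤ psInverse α β c⁻¹ p := by unfold psInverse; positivity
  have hle : psInverse α β c⁻¹ p ≤ psInverse α (β - 1) c⁻¹ p := by
    unfold psInverse
    gcongr
    linarith
  have hceil := Nat.ceil_mono hle
  have hceil' : ⌈psInverse α (β - 1) c⁻¹ p⌉₊ ≤ ⌈psInverse α β c⁻¹ p⌉₊ + 1 := by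
    rw [← Nat.ceil_add_one hu]
    exact Nat.ceil_mono (by linarith)
  rw [sub_add_sawtooth_neg_sub hu (hu.trans hle)]
  by_cases hmem : (p : ℤ) ∈ genPiatetskiShapiro α β c
  · have hlt := (natCast_mem_genPiatetskiShapiro_iff hα hc hp).1 hmem
    rw [Set.indicator_of_mem hmem, le_antisymm hceil' hlt]
    simp
  · have hge := not_lt.1 (mt (natCast_mem_genPiatetskiShapiro_iff hα hc hp).2 hmem)
    rw [Set.indicator_of_notMem hmem, le_antisymm hge hceil, sub_self]

theorem exists_rpow_add_one_sub_rpow_eq (γ : ℝ) {y : ℝ} (hy : 0 < y) :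
    ∃ ξ ∈ Set.Ioo y (y + 1), (y + 1) ^ γ - y ^ γ = γ * ξ ^ (γ - 1) := by
  have hderiv : ∀ t, y ≤ t → HasDerivAt (fun t : ℝ => t ^ γ) (γ * t ^ (γ - 1)) t := fun t ht =>
    Real.hasDerivAt_rpow_const (Or.inl (hy.trans_le ht).ne')
  obtain ⟨ξ, hξ, hslope⟩ := exists_hasDerivAt_eq_slope (fun t : ℝ => t ^ γ) _ (lt_add_one y)
    (fun t ht => (hderiv t ht.1).continuousAt.continuousWithinAt) (fun t ht => hderiv t ht.1.le)
  exact ⟨ξ, hξ, by rw [hslope, add_sub_cancel_left, div_one]⟩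

theorem abs_rpow_sub_rpow_le {s a x y : ℝ} (hs₀ : -1 ≤ s) (hs₁ : s ≤ 0) (ha : 1 ≤ a)
    (hx : a ≤ x) (hy : a ≤ y) : |x ^ s - y ^ s| ≤ a⁻¹ * |x - y| := by
  refine (convex_Ici a).norm_image_sub_le_of_norm_hasDerivWithin_le (f := fun t : ℝ => t ^ s)
    (f' := fun t => s * t ^ (s - 1)) (fun t ht => (Real.hasDerivAt_rpow_const
      (Or.inl (by linarith [Set.mem_Ici.1 ht] : 0 < t).ne')).hasDerivWithinAt)
    (fun t ht => ?_) hy hx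
  have hat : a ≤ t := ht
  have ht₀ : 0 < t := by linarith
  rw [norm_mul, Real.norm_of_nonneg (by positivity : 0 ≤ t ^ (s - 1))]
  calc |s| * t ^ (s - 1) ≤ 1 * t ^ (-1 : ℝ) := by
        gcongr
        · exact abs_le.2 ⟨hs₀, hs₁.trans zero_le_one⟩
        · linarith
        · linarith
    _ ≤ a⁻¹ := by
        rw [one_mul, Real.rpow_neg_one]
        gcongr

theorem psInverse_sub_psInverse_isBigO (β : ℝ) (hα : 0 < α) (hγ₀ : 0 ≤ γ) (hγ₁ : γ ≤ 1) :
    (fun t : ℝ => psInverse α (β - 1) γ t - psInverse α β γ t - α ^ (-γ) * γ * t ^ (γ - 1))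
      =O[atTop] fun t => t⁻¹ := by
  refine IsBigO.of_bound (α ^ (-γ) * (γ * (2 * (|β| + 1)))) ?_
  filter_upwards [eventually_ge_atTop (2 * |β| + 2)] with t ht
  have hβ := abs_le.1 (le_refl |β|)
  have ht₀ : 0 < t := by linarith
  obtain ⟨ξ, hξ, hmvt⟩ := exists_rpow_add_one_sub_rpow_eq γ (by linarith : 0 < t - β)
  have hgap : psInverse α (β - 1) γ t - psInverse α β γ t - α ^ (-γ) * γ * t ^ (γ - 1) =
      α ^ (-γ) * (γ * (ξ ^ (γ - 1) - t ^ (γ - 1))) := by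
    rw [psInverse, psInverse, Real.div_rpow (by linarith) hα.le, Real.div_rpow (by linarith) hα.le,
      Real.rpow_neg hα.le, show t - (β - 1) = t - β + 1 by ring, mul_sub γ, ← hmvt]
    ring
  have hξt : |ξ - t| ≤ |β| + 1 := abs_le.2 ⟨by linarith [hξ.1], by linarith [hξ.2]⟩
  have hrpow := abs_rpow_sub_rpow_le (s := γ - 1) (a := t / 2) (x := ξ) (y := t) (by linarith)
    (by linarith) (by linarith [abs_nonneg β]) (by linarith [hξ.1]) (by linarith)
  rw [hgap, Real.norm_eq_abs, abs_mul, abs_mul, abs_of_pos (by positivity), abs_of_nonneg hγ₀,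
    norm_inv, Real.norm_of_nonneg ht₀.le]
  calc _ ≤ α ^ (-γ) * (γ * ((t / 2)⁻¹ * (|β| + 1))) := by
        gcongr
        exact hrpow.trans (by gcongr)
    _ = _ := by
        field_simp

theorem tendsto_psInverse_sub_psInverse (β : ℝ) (hα : 0 < α) (hγ₀ : 0 ≤ γ) (hγ₁ : γ < 1) :
    Tendsto (fun t => psInverse α (β - 1) γ t - psInverse α β γ t) atTop (nhds 0) := by
  have herror := (psInverse_sub_psInverse_isBigO β hα hγ₀ hγ₁.le).trans_tendsto
    tendsto_inv_atTop_zero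
  have hmain : Tendsto (fun t : ℝ => α ^ (-γ) * γ * t ^ (γ - 1)) atTop (nhds 0) := by
    have := (tendsto_rpow_neg_atTop (by linarith : 0 < 1 - γ)).const_mul (α ^ (-γ) * γ)
    simpa only [neg_sub, mul_zero] using this
  simpa only [sub_add_cancel, add_zero] using herror.add hmain

/-- The error in approximating the indicator function of the sequence `⌊α * n ^ c + β⌋` by its
density together with the fluctuation of the fractional parts. -/
noncomputable def psRemainder (α β c : ℝ) (p : ℕ) : ℝ :=
  (genPiatetskiShapiro α β c).indicator 1 (p : ℤ) - (α ^ (-c⁻¹) * c⁻¹ * (p : ℝ) ^ (c⁻¹ - 1) +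
    (sawtooth (-psInverse α (β - 1) c⁻¹ p) - sawtooth (-psInverse α β c⁻¹ p)))

theorem psRemainder_isBigO (β : ℝ) (hα : 0 < α) (hc : 1 < c) :
    psRemainder α β c =O[atTop] fun p : ℕ => (p : ℝ)⁻¹ := by
  have hγ₀ : 0 ≤ c⁻¹ := inv_nonneg.2 (by linarith)
  have hγ₁ : c⁻¹ < 1 := inv_lt_one_of_one_lt₀ hc
  refine ((psInverse_sub_psInverse_isBigO β hα hγ₀ hγ₁.le).comp_tendsto
    tendsto_natCast_atTop_atTop).congr' ?_ EventuallyEq.rfl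
  filter_upwards [tendsto_natCast_atTop_atTop.eventually_gt_atTop β,
    tendsto_natCast_atTop_atTop.eventually ((tendsto_psInverse_sub_psInverse β hα hγ₀
      hγ₁).eventually_le_const zero_lt_one)] with p hp hgap
  rw [psRemainder, indicator_genPiatetskiShapiro_eq hα (by linarith) hp hgap, Function.comp_apply]
  ring

end PiatetskiShapiro

section MainTheorem

open Finset

variable {α β c γ x : ℝ} {q : ℕ} {a : ℤ}

/-- The summand `log n`, restricted to the primes `n ≡ a (mod q)`, of `thetaAP`, as a sequence
suitable for partial summation. -/
noncomputable def logPrimeAP (q : ℕ) (a : ℤ) (n : ℕ) : ℝ :=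
  if n.Prime ∧ (n : ℤ) ≡ a [ZMOD (q : ℤ)] then Real.log n else 0

theorem sum_mul_logPrimeAP (t : ℝ) (q : ℕ) (a : ℤ) (g : ℕ → ℝ) :
    ∑ n ∈ Icc 0 ⌊t⌋₊, g n * logPrimeAP q a n = ∑ p ∈ primesAP t q a, Real.log p * g p := by
  have hset : primesAP t q a =
      (Icc 0 ⌊t⌋₊).filter fun n : ℕ => n.Prime ∧ (n : ℤ) ≡ a [ZMOD (q : ℤ)] := by
    ext p
    simp only [primesAP, mem_filter, mem_Icc]
    exact ⟨fun ⟨h, hp⟩ => ⟨⟨p.zero_le, h.2⟩, hp⟩, fun ⟨h, hp⟩ => ⟨⟨hp.1.pos, h.2⟩, hp⟩⟩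
  rw [hset, sum_filter]
  exact sum_congr rfl fun n _ => by rw [logPrimeAP, mul_ite, mul_zero, mul_comm]

theorem sum_logPrimeAP (t : ℝ) (q : ℕ) (a : ℤ) :
    ∑ n ∈ Icc 0 ⌊t⌋₊, logPrimeAP q a n = thetaAP t q a := by
  have hsum := sum_mul_logPrimeAP t q a 1
  simp only [Pi.one_apply, one_mul, mul_one] at hsum
  exact hsum

theorem sum_log_mul_rpow_primesAP_eq (γ : ℝ) (hx : 2 ≤ x) :
    ∑ p ∈ primesAP x q a, Real.log p * (p : ℝ) ^ (γ - 1) =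
      x ^ (γ - 1) * thetaAP x q a +
        (1 - γ) * ∫ u in (2 : ℝ)..x, u ^ (γ - 2) * thetaAP u q a := by
  have hderiv : ∀ t ∈ Set.Icc 2 x,
      HasDerivAt (fun t : ℝ => t ^ (γ - 1)) ((γ - 1) * t ^ (γ - 2)) t := fun t ht => by
    convert Real.hasDerivAt_rpow_const (p := γ - 1) (Or.inl (by linarith [ht.1] : 0 < t).ne')
      using 3
    ring
  have hcont : ContinuousOn (fun t : ℝ => (γ - 1) * t ^ (γ - 2)) (Set.Icc 2 x) :=
    continuousOn_const.mul (continuousOn_id.rpow_const fun t ht =>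
      Or.inl (by linarith [ht.1] : (0 : ℝ) < t).ne')
  have habel := sum_mul_eq_sub_integral_mul₁ (f := fun t : ℝ => t ^ (γ - 1)) (logPrimeAP q a)
    (by simp [logPrimeAP]) (by simp [logPrimeAP]) x (fun t ht => (hderiv t ht).differentiableAt)
    (hcont.integrableOn_Icc.congr_fun (fun t ht => (hderiv t ht).deriv.symm) measurableSet_Icc)
  simp_rw [sum_mul_logPrimeAP x q a fun p => (p : ℝ) ^ (γ - 1), sum_logPrimeAP] at habel
  rw [habel, sub_eq_add_neg, ← intervalIntegral.integral_of_le hx,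
    ← intervalIntegral.integral_neg, ← intervalIntegral.integral_const_mul]
  congr 1
  refine intervalIntegral.integral_congr fun t ht => ?_
  rw [Set.uIcc_of_le hx] at ht
  simp only [(hderiv t ht).deriv]
  ring

theorem sum_log_mul_inv_primesAP_le (hx : 1 ≤ x) :
    ∑ p ∈ primesAP x q a, Real.log p * (p : ℝ)⁻¹ ≤ (1 + Real.log x) ^ 2 := by
  have hlog := Real.log_nonneg hx
  have hharmonic : ∑ n ∈ Icc 1 ⌊x⌋₊, (n : ℝ)⁻¹ ≤ 1 + Real.log x := by
    have hle := harmonic_le_one_add_log ⌊x⌋₊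
    rw [harmonic_eq_sum_Icc] at hle
    push_cast at hle
    refine hle.trans ?_
    gcongr
    · exact_mod_cast Nat.floor_pos.2 hx
    · exact Nat.floor_le (by linarith)
  calc _ ≤ ∑ p ∈ primesAP x q a, Real.log x * (p : ℝ)⁻¹ :=
        sum_le_sum fun p hp =>
          mul_le_mul_of_nonneg_right (log_le_of_mem_primesAP hp) (by positivity)
    _ ≤ ∑ n ∈ Icc 1 ⌊x⌋₊, Real.log x * (n : ℝ)⁻¹ :=
        sum_le_sum_of_subset_of_nonneg (filter_subset _ _) fun n _ _ => by positivity
    _ = Real.log x * ∑ n ∈ Icc 1 ⌊x⌋₊, (n : ℝ)⁻¹ := by rw [mul_sum]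
    _ ≤ (1 + Real.log x) * (1 + Real.log x) := by
        gcongr
        linarith
    _ = _ := by ring

theorem exists_abs_sum_log_mul_psRemainder_le (β : ℝ) (hα : 0 < α) (hc : 1 < c) :
    ∃ C : ℝ, 0 < C ∧ ∀ (q : ℕ) (a : ℤ) (x : ℝ), 1 ≤ x →
      |∑ p ∈ primesAP x q a, Real.log p * psRemainder α β c p| ≤ C * x ^ (1 / 2 : ℝ) := by
  obtain ⟨K, hK, hKb⟩ :=
    Asymptotics.bound_of_isBigO_nat_atTop (psRemainder_isBigO β hα hc)
  refine ⟨K * 25, by positivity, fun q a x hx => ?_⟩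
  have hx₀ : 0 < x := by linarith
  have hlog := Real.log_nonneg hx
  calc _ ≤ ∑ p ∈ primesAP x q a, K * (Real.log p * (p : ℝ)⁻¹) := by
        refine (abs_sum_le_sum_abs _ _).trans (sum_le_sum fun p hp => ?_)
        have hp₀ : (p : ℝ) ≠ 0 :=
          Nat.cast_ne_zero.2 (Nat.one_le_iff_ne_zero.1 (one_le_of_mem_primesAP hp))
        have hlogp := log_nonneg_of_mem_primesAP hp
        have hrem := hKb (inv_ne_zero hp₀)
        rw [norm_inv, Real.norm_natCast, Real.norm_eq_abs] at hrem
        rw [abs_mul, abs_of_nonneg hlogp, mul_left_comm]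
        gcongr
    _ = K * ∑ p ∈ primesAP x q a, Real.log p * (p : ℝ)⁻¹ := by rw [mul_sum]
    _ ≤ K * (1 + Real.log x) ^ 2 := by
        gcongr
        exact sum_log_mul_inv_primesAP_le hx
    _ ≤ K * ((1 + 1 / (1 / 4)) * x ^ (1 / 4 : ℝ)) ^ 2 := by
        gcongr
        exact one_add_log_le_mul_rpow hx (by norm_num)
    _ = _ := by
        rw [mul_pow, ← Real.rpow_natCast (x ^ (1 / 4 : ℝ)), ← Real.rpow_mul hx₀.le]
        norm_num
        ring

theorem thetaPS_eq_sum_indicator :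
    thetaPS α β c x q a =
      ∑ p ∈ primesAP x q a, Real.log p * (genPiatetskiShapiro α β c).indicator 1 (p : ℤ) := by
  classical
  simp_rw [Set.indicator_apply, Pi.one_apply, mul_ite, mul_one, mul_zero]
  rw [← sum_filter, primesAP, filter_filter, thetaPS]
  exact sum_congr (filter_congr fun p _ => by tauto) fun _ _ => rfl

theorem thetaPS_sub_mainTerm_eq (hx : 2 ≤ x) (hγ : γ = c⁻¹) :
    thetaPS α β c x q a -
        (α ^ (-γ) * γ * x ^ (γ - 1) * thetaAP x q a +
          α ^ (-γ) * γ * (1 - γ) * ∫ u in (2 : ℝ)..x, u ^ (γ - 2) * thetaAP u q a) =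
      ∑ p ∈ primesAP x q a, Real.log p * psRemainder α β c p +
        (sawtoothSum α (β - 1) γ x q a - sawtoothSum α β γ x q a) := by
  subst hγ
  have hmain : α ^ (-c⁻¹) * c⁻¹ * x ^ (c⁻¹ - 1) * thetaAP x q a +
      α ^ (-c⁻¹) * c⁻¹ * (1 - c⁻¹) * ∫ u in (2 : ℝ)..x, u ^ (c⁻¹ - 2) * thetaAP u q a =
      α ^ (-c⁻¹) * c⁻¹ * ∑ p ∈ primesAP x q a, Real.log p * (p : ℝ) ^ (c⁻¹ - 1) := by
    rw [sum_log_mul_rpow_primesAP_eq c⁻¹ hx]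
    ring
  rw [hmain, thetaPS_eq_sum_indicator, sawtoothSum, sawtoothSum, mul_sum, ← sum_sub_distrib,
    ← sum_sub_distrib, ← sum_add_distrib]
  exact sum_congr rfl fun p _ => by rw [psRemainder]; ring

end MainTheorem

theorem theorem3_general (α β c γ ε : ℝ) (hα : 0 < α) (hc₁ : 1 < c) (hc₂ : c ≤ 12 / 11)
    (hγ : γ = c⁻¹) (hε : 0 < ε) :
    ∃ C : ℝ, 0 < C ∧ ∀ (q : ℕ) (a : ℤ) (x : ℝ), 1 ≤ q → 2 ≤ x →
      |thetaPS α β c x q a -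
          (α ^ (-γ) * γ * x ^ (γ - 1) * thetaAP x q a +
            α ^ (-γ) * γ * (1 - γ) * ∫ u in (2 : ℝ)..x, u ^ (γ - 2) * thetaAP u q a)|
        ≤ C * x ^ (γ / 7 + 11 / 14 + ε) := by
  have hγ₁ : γ < 1 := hγ ▸ inv_lt_one_of_one_lt₀ hc₁
  have hγ₀ : 11 / 12 ≤ γ := by
    rw [hγ, le_inv_comm₀ (by norm_num) (by linarith)]
    linarith
  have hδ₀ : 0 ≤ (3 - 2 * γ) / 14 := by linarith
  obtain ⟨C, hC, hrem⟩ := exists_abs_sum_log_mul_psRemainder_le β hα hc₁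
  obtain ⟨C₀, hC₀, hsum₀⟩ :=
    exists_abs_sawtoothSum_le (β := β) hα hγ₀ hγ₁ hδ₀ le_rfl hε
  obtain ⟨C₁, hC₁, hsum₁⟩ :=
    exists_abs_sawtoothSum_le (β := β - 1) hα hγ₀ hγ₁ hδ₀ le_rfl hε
  refine ⟨C + (C₁ + C₀), by positivity, fun q a x hq hx => ?_⟩
  have hx₁ : 1 ≤ x := by linarith
  rw [show γ / 7 + 11 / 14 + ε = 1 - (3 - 2 * γ) / 14 + ε by ring,
    thetaPS_sub_mainTerm_eq hx hγ, add_mul, add_mul]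
  refine (abs_add_le _ _).trans (add_le_add ((hrem q a x hx₁).trans ?_)
    ((abs_sub _ _).trans (add_le_add (hsum₁ q a x hq (by linarith))
      (hsum₀ q a x hq (by linarith)))))
  gcongr
  linarith

theorem theorem3 (α β c γ ε : ℝ) (hα : 1 ≤ α) (hc₁ : 1 < c) (hc₂ : c < 12 / 11)
    (hγ : γ = c⁻¹) (hε : 0 < ε) :
    ∃ C : ℝ, 0 < C ∧ ∀ (q : ℕ) (a : ℤ) (x : ℝ), 1 ≤ q → 2 ≤ x →
      |thetaPS α β c x q a -
          (α ^ (-γ) * γ * x ^ (γ - 1) * thetaAP x q a +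
            α ^ (-γ) * γ * (1 - γ) * ∫ u in (2 : ℝ)..x, u ^ (γ - 2) * thetaAP u q a)|
        ≤ C * x ^ (7 * γ / 13 + 11 / 26 + ε) := by
  have hγ₀ : 11 / 12 ≤ γ := by
    rw [hγ, le_inv_comm₀ (by norm_num) (by linarith)]
    linarith
  obtain ⟨C, hC, hbound⟩ := theorem3_general α β c γ ε (by linarith) hc₁ hc₂.le hγ hε
  exact ⟨C, hC, fun q a x hq hx => (hbound q a x hq hx).trans
    (by gcongr C * x ^ ?_ <;> linarith)⟩
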